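/- A family $\gamma(\cdot,t)$, $t\in I$, of immersed curves in $\mathbb{R}^n$, smooth in $(p,t)$, is a curve shortening flow if $\partial_t\gamma=\kappa N$, where $\kappa N:=\partial_s T$ is the curvature vector, $T=\partial_s\gamma$ is the unit tangent, $\partial_s=|\partial_p\gamma|^{-1}\partial_p$ and $\kappa=|\partial_sT|$. Let $\gamma:S^1\times[0,\omega)\to\mathbb{R}^n$ be a curve shortening flow of closed curves, $S^1=\mathbb{R}/2\pi\mathbb{Z}$, and put $K_t=\sup_{S^1}\kappa^2(\cdot,t)$. Let $(p_j,t_j)\in S^1\times[0,\omega)$ be an essential blow-up sequence, that is, $t_j\to\omega$, $\kappa^2(p_j,t_j)\to\infty$, and there is $\rho>0$ such that $\rho K_t\le\kappa^2(p_j,t_j)$ for all $j$ and all $0\le t<t_j$. Put $\lambda_j=\kappa(p_j,t_j)$ and define the rescaled flows $$\gamma_j(\cdot,\bar t)=\lambda_j\bigl(A_j\gamma(\cdot,t)+b_j\bigr),\qquad \bar t=\lambda_j^2(t-t_j)\in[-\lambda_j^2t_j,\ \lambda_j^2(\omega-t_j)),$$ where $A_j\in\mathrm{O}(n)$ and $b_j\in\mathbb{R}^n$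 are any choices such that, for every $j$ with $\lambda_j>0$, the curve $\gamma_j(\cdot,0)$ has position $0$, unit tangent $e_1$ and unit normal $e_2$ at $p_j$. Then there are a subsequence (again indexed by $j$) and a curve shortening flow $\gamma_\infty:\mathbb{R}\times(-\infty,0]\to\mathbb{R}^n$ of smoothly immersed curves such that, after pulling $\gamma_j$ back to $\mathbb{R}$ by the time-independent parametrisation $P_j:\mathbb{R}\to S^1$ by arclength of $\gamma_j(\cdot,0)$ starting at $P_j(0)=p_j$, the flows $\gamma_j(P_j(x),\bar t)$ converge to $\gamma_\infty(x,\bar t)$ smoothly on compact subsets of $\mathbb{R}\times(-\infty,0]$, i.e. all derivatives in $(x,\bar t)$, of every order $k\ge0$, converge uniformly on every compact subset (on which $\gamma_j(P_j(x),\bar t)$ is defined for all large $j$). Moreover $\gamma_\infty$ is nontrivial: the curve $\gamma_\infty(\cdot,0)$ is not contained in a straight line. -/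

import Mathlib

noncomputable section

namespace CurveShortening

/-! ## Geometry of a parametrised curve -/

section Curve

variable {E : Type*} [NormedAddCommGroup E] [NormedSpace ℝ E]

/-- The speed `v = |∂c/∂p|` of a parametrised curve `c`. -/
def speed (c : ℝ → E) (p : ℝ) : ℝ := ‖deriv c p‖

/-- The arclength derivative `∂f/∂s = v⁻¹ ∂f/∂p` of a function `f` along the curve `c`. -/
def arcDeriv (c f : ℝ → E) (p : ℝ) : E := (speed c p)⁻¹ • deriv f p

/-- The unit tangent `T = ∂c/∂s`. -/
def unitTangent (c : ℝ → E) (p : ℝ) : E := arcDeriv c c p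

/-- The curvature vector `∂T/∂s`. It is `κ N` wherever `κ ≠ 0`, and it is the meaning of `κ N`
at the points with `κ = 0`, where `N` is not defined. -/
def curvatureVector (c : ℝ → E) (p : ℝ) : E := arcDeriv c (unitTangent c) p

/-- The curvature `κ = |∂T/∂s|`. -/
def curvature (c : ℝ → E) (p : ℝ) : ℝ := ‖curvatureVector c p‖

/-- The principal unit normal `N = κ⁻¹ ∂T/∂s` (meaningful where `κ ≠ 0`). -/
def unitNormal (c : ℝ → E) (p : ℝ) : E := (curvature c p)⁻¹ • curvatureVector c p

/-- `P` is the parametrisation of the parameter line of `c` by signed arclength from `p`: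
`P x` is the parameter of the point at signed arclength `x` from `c p`. In particular
`P 0 = p`, and `c ∘ P` has unit speed. -/
def IsArclengthParametrisation (c : ℝ → E) (p : ℝ) (P : ℝ → ℝ) : Prop :=
  ∀ x : ℝ, ∫ q in p..(P x), speed c q = x

/-! ## Curve shortening flow -/

/-- A smooth family of immersed curves `γ (·, t) : ℝ → E`, `t ∈ I`, with `∂γ/∂t = κ N`.
At an endpoint of the time interval `I` that belongs to `I`, time derivatives are one-sided. -/
structure IsFlow (γ : ℝ → ℝ → E) (I : Set ℝ) : Prop where
  smooth : ContDiffOn ℝ ((⊤ : ℕ∞) : WithTop ℕ∞) (fun z : ℝ × ℝ => γ z.1 z.2) (Set.univ ×ˢ I)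
  immersed : ∀ t ∈ I, ∀ p : ℝ, deriv (fun q => γ q t) p ≠ 0
  flow : ∀ t ∈ I, ∀ p : ℝ,
    HasDerivWithinAt (fun τ => γ p τ) (curvatureVector (fun q => γ q t) p) I t

/-- A curve shortening flow of closed curves: `S¹` is the real line modulo `2π`. -/
structure IsClosedFlow (γ : ℝ → ℝ → E) (I : Set ℝ) : Prop extends IsFlow γ I where
  periodic : ∀ t ∈ I, Function.Periodic (fun p => γ p t) (2 * Real.pi)

/-- `K_t = sup κ²(·, t)`. -/
def maxSqCurvature (γ : ℝ → ℝ → E) (t : ℝ) : ℝ :=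
  ⨆ p : ℝ, curvature (fun q => γ q t) p ^ 2

/-! ## Blow-up sequences -/

/-- `(p_j, t_j)` is a blow-up sequence: `t_j ∈ [0, ω)`, `t_j → ω` and `κ²(p_j, t_j) → ∞`. -/
structure IsBlowUpSequence (γ : ℝ → ℝ → E) (ω : ℝ) (p t : ℕ → ℝ) : Prop where
  mem : ∀ j, t j ∈ Set.Ico 0 ω
  time : Filter.Tendsto t Filter.atTop (nhds ω)
  blowUp : Filter.Tendsto (fun j => curvature (fun q => γ q (t j)) (p j) ^ 2)
    Filter.atTop Filter.atTop

/-- An essential blow-up sequence: for some `ρ > 0`, `ρ K_τ ≤ κ²(p_j, t_j)` for all `τ < t_j`. -/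
structure IsEssentialBlowUpSequence (γ : ℝ → ℝ → E) (ω : ℝ) (p t : ℕ → ℝ) : Prop
    extends IsBlowUpSequence γ ω p t where
  essential : ∃ ρ : ℝ, 0 < ρ ∧ ∀ j, ∀ τ : ℝ, 0 ≤ τ → τ < t j →
    ρ * maxSqCurvature γ τ ≤ curvature (fun q => γ q (t j)) (p j) ^ 2

end Curve

/-! ## The blow-up procedure -/

section BlowUp

variable {n : ℕ}

/-- The vector of `ℝⁿ` whose coordinate number `k` (counted from `0`) is `1` and whose other
coordinates are `0`. -/
def stdVector (n k : ℕ) : EuclideanSpace ℝ (Fin n) :=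
  WithLp.toLp 2 (fun i : Fin n => if (i : ℕ) = k then 1 else 0)

/-- The scale `λ_j = κ(p_j, t_j)`. -/
def scale (γ : ℝ → ℝ → EuclideanSpace ℝ (Fin n)) (p t : ℕ → ℝ) (j : ℕ) : ℝ :=
  curvature (fun q => γ q (t j)) (p j)

/-- The rescaled flow `γ_j(p, τ) = λ_j (A_j γ(p, t) + b_j)`, where `τ = λ_j² (t - t_j)`.
Its values are meaningful for `τ ∈ [-λ_j² t_j, λ_j² (ω - t_j))` and `λ_j ≠ 0`. -/
def rescaledFlow (γ : ℝ → ℝ → EuclideanSpace ℝ (Fin n)) (p t : ℕ → ℝ)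
    (A : ℕ → EuclideanSpace ℝ (Fin n) ≃ₗᵢ[ℝ] EuclideanSpace ℝ (Fin n))
    (b : ℕ → EuclideanSpace ℝ (Fin n)) (j : ℕ) (q τ : ℝ) : EuclideanSpace ℝ (Fin n) :=
  scale γ p t j • (A j (γ q (t j + τ / scale γ p t j ^ 2)) + b j)

/-- The normalisation of the rigid motions `x ↦ A_j x + b_j`: for every `j` with
`λ_j = κ(p_j, t_j) > 0`, the rescaled flow at the point `p_j` and time `0` has position `0`,
unit tangent `e₁` and unit normal `e₂`. The isometries may preserve or reverse the orientation,
and the images of the binormals are left free, so every choice of them is covered: at a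
degenerate point they are not determined by the curve. -/
def IsNormalised (γ : ℝ → ℝ → EuclideanSpace ℝ (Fin n)) (p t : ℕ → ℝ)
    (A : ℕ → EuclideanSpace ℝ (Fin n) ≃ₗᵢ[ℝ] EuclideanSpace ℝ (Fin n))
    (b : ℕ → EuclideanSpace ℝ (Fin n)) : Prop :=
  ∀ j, 0 < scale γ p t j →
    rescaledFlow γ p t A b j (p j) 0 = 0 ∧
    unitTangent (fun q => rescaledFlow γ p t A b j q 0) (p j) = stdVector n 0 ∧
    unitNormal (fun q => rescaledFlow γ p t A b j q 0) (p j) = stdVector n 1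

end BlowUp

/-! ## Smooth convergence on compact sets -/

/-- Smooth convergence on compact subsets of `S`: derivatives of every order `k ≥ 0`
converge uniformly on every compact subset of `S`. -/
def SmoothlyConvergesOn {V E : Type*} [NormedAddCommGroup V] [NormedSpace ℝ V]
    [NormedAddCommGroup E] [NormedSpace ℝ E] (F : ℕ → V → E) (G : V → E) (S : Set V) : Prop :=
  ∀ k : ℕ, ∀ K : Set V, K ⊆ S → IsCompact K →
    TendstoUniformlyOn (fun j => iteratedFDerivWithin ℝ k (F j) S)
      (iteratedFDerivWithin ℝ k G S) Filter.atTop K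

end CurveShortening

end

/-!
# Blow-up limits of the curve shortening flow

An essential blow-up sequence is rescaled so that the curvature is `1` at the base point and at most
`ρ^(-1/2)` at all earlier times. The theorem says that flows with such a curvature bound are compact
in the smooth topology; it rests on interior estimates and on a compactness argument.

*Interior estimates.* Write `T⁽ᵐ⁾ = ∂ₛᵐ T` for the arclength derivatives of the unit tangent, so that
`T⁽¹⁾` is the curvature vector. Since `∂ₜ ∂ₛ = ∂ₛ ∂ₜ + κ² ∂ₛ` (`StripFlow.dT_dS`), they satisfy
`∂ₜ T⁽ᵐ⁾ = ∂ₛ² T⁽ᵐ⁾ + Σ ⟨T⁽ⁱ⁾, T⁽ʲ⁾⟩ T⁽ᵏ⁾` with `i + j + k = m + 2` and `i, j ≥ 1`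
(`StripFlow.dT_tangentDeriv`, `StripFlow.reactionList_spec`). Bernstein's trick, the maximum principle
for `(t - t₀) |T⁽ᵐ⁺¹⁾|² + B |T⁽ᵐ⁾|²` on a closed curve, turns a bound for the curvature on a time
interval `(a, 0]` into a bound for `T⁽ᵐ⁺¹⁾` on `(a + m, 0]` that depends on nothing else
(`le_add_of_subsolution`, `StripFlow.exists_bound_tangentDeriv`). The time intervals of the rescaled
flows exhaust the past, so in the limit no time is lost.

*From geometric to coordinate derivatives.* If the curves are parametrised by arclength at time `0`,
then the speed `v` satisfies `∂ₜ log v = -κ²` and `log v = 0` at time `0`. The derivatives `∂ₓᵏ log v`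
are bounded by induction on `k`, because `∂ₓᵏ⁺¹ κ²` is a polynomial in `v`, the components of the
`T⁽ᵐ⁾` and `∂ₓⁱ log v` with `i ≤ k`. All these quantities together generate an algebra that is closed
under `∂ₓ` and `∂ₜ` and consists of locally bounded functions; this bounds every derivative of the flow
(`NormalisedFlows.locBdd_iteratedFDeriv_position`).

*Compactness.* A sequence with locally bounded derivatives of all orders on the convex set
`ℝ × (-∞, 0]` has a subsequence along which all derivatives converge on a countable dense set; the
bounds make the convergence locally uniform, and the second order Taylor estimate passes to the limit,
so the limits are the derivatives of the limit (`exists_subseq_smoothlyConvergesOn`).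

The limit is immersed since the speed is at least `1` at nonpositive times (`StripFlow.one_le_flowSpeed`),
it is a flow because the curvature vector is a continuous function of the first two derivatives, and it
is not a line because its curvature vector at the base point is the unit vector `e₂`
(`NormalisedFlows.exists_limit`).
-/

noncomputable section

namespace CurveShortening

open Set Filter Topology
open scoped ContDiff RealInnerProductSpace

/-! ### Derivatives along a fixed vector on an open set -/

section DirectionalDerivative

variable {V : Type*} [NormedAddCommGroup V] [NormedSpace ℝ V]
variable {F : Type*} [NormedAddCommGroup F] [NormedSpace ℝ F]
variable {H : Type*} [NormedAddCommGroup H] [InnerProductSpace ℝ H]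

/-- The derivative of `f` along the constant vector field `w`. -/
def dirDeriv (w : V) (f : V → F) (z : V) : F := fderiv ℝ f z w

variable {w w' : V} {U : Set V} {z : V}

lemma differentiableAt_of_contDiffOn {f : V → F} (hU : IsOpen U) (hf : ContDiffOn ℝ ∞ f U)
    (hz : z ∈ U) : DifferentiableAt ℝ f z :=
  (hf.contDiffAt (hU.mem_nhds hz)).differentiableAt (by simp)

lemma contDiffOn_dirDeriv {f : V → F} (hU : IsOpen U) (hf : ContDiffOn ℝ ∞ f U) :
    ContDiffOn ℝ ∞ (dirDeriv w f) U :=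
  (hf.fderiv_of_isOpen hU (by simp)).clm_apply contDiffOn_const

lemma dirDeriv_congr {f g : V → F} (hU : IsOpen U) (h : EqOn f g U) :
    EqOn (dirDeriv w f) (dirDeriv w g) U := fun z hz => by
  have : f =ᶠ[𝓝 z] g := h.eventuallyEq_of_mem (hU.mem_nhds hz)
  simp only [dirDeriv, this.fderiv_eq]

lemma dirDeriv_add {f g : V → F} (hf : DifferentiableAt ℝ f z) (hg : DifferentiableAt ℝ g z) :
    dirDeriv w (fun y => f y + g y) z = dirDeriv w f z + dirDeriv w g z := by
  simp [dirDeriv, fderiv_fun_add hf hg]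

lemma dirDeriv_smul {r : V → ℝ} {f : V → F} (hr : DifferentiableAt ℝ r z)
    (hf : DifferentiableAt ℝ f z) :
    dirDeriv w (fun y => r y • f y) z = r z • dirDeriv w f z + dirDeriv w r z • f z := by
  simp [dirDeriv, fderiv_fun_smul hr hf]

lemma dirDeriv_mul {r f : V → ℝ} (hr : DifferentiableAt ℝ r z)
    (hf : DifferentiableAt ℝ f z) :
    dirDeriv w (fun y => r y * f y) z = r z * dirDeriv w f z + dirDeriv w r z * f z := by
  simp [dirDeriv, fderiv_fun_mul hr hf, mul_comm]

lemma dirDeriv_inner {f g : V → H} (hf : DifferentiableAt ℝ f z) (hg : DifferentiableAt ℝ g z) :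
    dirDeriv w (fun y => ⟪f y, g y⟫) z = ⟪dirDeriv w f z, g z⟫ + ⟪f z, dirDeriv w g z⟫ := by
  simp [dirDeriv, fderiv_inner_apply ℝ hf hg, add_comm]

lemma dirDeriv_comm {f : V → F} (hU : IsOpen U) (hf : ContDiffOn ℝ ∞ f U) (hz : z ∈ U) :
    dirDeriv w (dirDeriv w' f) z = dirDeriv w' (dirDeriv w f) z := by
  have h1 : DifferentiableAt ℝ (fderiv ℝ f) z :=
    differentiableAt_of_contDiffOn hU (hf.fderiv_of_isOpen hU (by simp)) hz
  have key : ∀ a b : V, dirDeriv a (dirDeriv b f) z = fderiv ℝ (fderiv ℝ f) z a b := by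
    intro a b
    have : fderiv ℝ (fun y => fderiv ℝ f y b) z a = fderiv ℝ (fderiv ℝ f) z a b := by
      rw [fderiv_clm_apply h1 (differentiableAt_const b)]
      simp
    exact this
  rw [key, key]
  have h2 : ContDiffAt ℝ ∞ f z := hf.contDiffAt (hU.mem_nhds hz)
  exact (h2.isSymmSndFDerivAt (by
    simpa using (WithTop.coe_le_coe.2 le_top : ((2 : ℕ∞) : WithTop ℕ∞) ≤ ∞))).eq _ _

end DirectionalDerivative

/-! ### Curve shortening flows on an open time interval -/

/-- The set `ℝ × (a, b)` of parameters and times. -/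
def strip (a b : ℝ) : Set (ℝ × ℝ) := univ ×ˢ Ioo a b

lemma isOpen_strip (a b : ℝ) : IsOpen (strip a b) := isOpen_univ.prod isOpen_Ioo

lemma mem_strip {a b : ℝ} {z : ℝ × ℝ} : z ∈ strip a b ↔ a < z.2 ∧ z.2 < b := by
  simp [strip]

section Flow

variable {F : Type*} [NormedAddCommGroup F] [NormedSpace ℝ F]
variable {E : Type*} [NormedAddCommGroup E] [InnerProductSpace ℝ E]

/-- The derivative `∂/∂x` with respect to the curve parameter. -/
notation "∂ₓ" => dirDeriv ((1 : ℝ), (0 : ℝ))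

/-- The derivative `∂/∂t` with respect to time. -/
notation "∂ₜ" => dirDeriv ((0 : ℝ), (1 : ℝ))

/-- The arclength derivative `v⁻¹ ∂f/∂x` for the speed function `v`. -/
def dS (v : ℝ × ℝ → ℝ) (f : ℝ × ℝ → F) (z : ℝ × ℝ) : F := (v z)⁻¹ • ∂ₓ f z

/-- The speed `|∂G/∂x|` of a family of curves, as a function of parameter and time. -/
def flowSpeed (G : ℝ × ℝ → E) (z : ℝ × ℝ) : ℝ := ‖∂ₓ G z‖

/-- The arclength derivative `∂ₛᵐ T` of order `m` of the unit tangent `T` of a family of curves: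
`m = 0` gives the unit tangent and `m = 1` the curvature vector. -/
def tangentDeriv (G : ℝ × ℝ → E) : ℕ → ℝ × ℝ → E
  | 0 => dS (flowSpeed G) G
  | m + 1 => dS (flowSpeed G) (tangentDeriv G m)

/-- A curve shortening flow on the open time interval `(a, b)`. -/
structure StripFlow (G : ℝ × ℝ → E) (a b : ℝ) : Prop where
  smooth : ContDiffOn ℝ ∞ G (strip a b)
  immersed : ∀ z ∈ strip a b, ∂ₓ G z ≠ 0
  flow : ∀ z ∈ strip a b, ∂ₜ G z = tangentDeriv G 1 z

variable {U : Set (ℝ × ℝ)} {v : ℝ × ℝ → ℝ} {z : ℝ × ℝ}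

lemma contDiffOn_dS {f : ℝ × ℝ → F} (hU : IsOpen U) (hv : ContDiffOn ℝ ∞ v U)
    (hv0 : ∀ z ∈ U, v z ≠ 0) (hf : ContDiffOn ℝ ∞ f U) : ContDiffOn ℝ ∞ (dS v f) U :=
  (hv.inv hv0).smul (contDiffOn_dirDeriv hU hf)

lemma dS_congr {f g : ℝ × ℝ → F} (hU : IsOpen U) (h : EqOn f g U) :
    EqOn (dS v f) (dS v g) U := fun z hz => by
  simp only [dS, dirDeriv_congr hU h hz]

lemma dS_add {f g : ℝ × ℝ → F} (hf : DifferentiableAt ℝ f z) (hg : DifferentiableAt ℝ g z) :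
    dS v (fun y => f y + g y) z = dS v f z + dS v g z := by
  simp [dS, dirDeriv_add hf hg]

lemma dS_smul {r : ℝ × ℝ → ℝ} {f : ℝ × ℝ → F} (hr : DifferentiableAt ℝ r z)
    (hf : DifferentiableAt ℝ f z) :
    dS v (fun y => r y • f y) z = r z • dS v f z + dS v r z • f z := by
  simp only [dS, dirDeriv_smul hr hf, smul_add, smul_smul, smul_eq_mul]
  rw [mul_comm]

lemma dS_inner {f g : ℝ × ℝ → E} (hf : DifferentiableAt ℝ f z) (hg : DifferentiableAt ℝ g z) :
    dS v (fun y => ⟪f y, g y⟫) z = ⟪dS v f z, g z⟫ + ⟪f z, dS v g z⟫ := by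
  simp [dS, dirDeriv_inner hf hg, inner_smul_left, inner_smul_right, mul_add]

namespace StripFlow

variable {G : ℝ × ℝ → E} {a b : ℝ}

lemma flowSpeed_pos (h : StripFlow G a b) (hz : z ∈ strip a b) : 0 < flowSpeed G z :=
  norm_pos_iff.2 (h.immersed z hz)

lemma contDiffOn_flowSpeed (h : StripFlow G a b) : ContDiffOn ℝ ∞ (flowSpeed G) (strip a b) :=
  (contDiffOn_dirDeriv (isOpen_strip a b) h.smooth).norm ℝ h.immersed

lemma contDiffOn_dS (h : StripFlow G a b) {f : ℝ × ℝ → F} (hf : ContDiffOn ℝ ∞ f (strip a b)) :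
    ContDiffOn ℝ ∞ (dS (flowSpeed G) f) (strip a b) :=
  CurveShortening.contDiffOn_dS (isOpen_strip a b) h.contDiffOn_flowSpeed
    (fun _ hz => (h.flowSpeed_pos hz).ne') hf

lemma contDiffOn_tangentDeriv (h : StripFlow G a b) (m : ℕ) :
    ContDiffOn ℝ ∞ (tangentDeriv G m) (strip a b) := by
  induction m with
  | zero => exact h.contDiffOn_dS h.smooth
  | succ m ih => exact h.contDiffOn_dS ih

lemma differentiableAt_tangentDeriv (h : StripFlow G a b) (m : ℕ) (hz : z ∈ strip a b) :
    DifferentiableAt ℝ (tangentDeriv G m) z :=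
  differentiableAt_of_contDiffOn (isOpen_strip a b) (h.contDiffOn_tangentDeriv m) hz

lemma dX_eq (h : StripFlow G a b) {f : ℝ × ℝ → F} (hz : z ∈ strip a b) :
    ∂ₓ f z = flowSpeed G z • dS (flowSpeed G) f z := by
  simp [dS, smul_smul, mul_inv_cancel₀ (h.flowSpeed_pos hz).ne']

lemma dX_tangentDeriv (h : StripFlow G a b) (m : ℕ) (hz : z ∈ strip a b) :
    ∂ₓ (tangentDeriv G m) z = flowSpeed G z • tangentDeriv G (m + 1) z :=
  h.dX_eq hz

lemma norm_tangent (h : StripFlow G a b) (hz : z ∈ strip a b) : ‖tangentDeriv G 0 z‖ = 1 := by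
  have := h.flowSpeed_pos hz
  simp only [tangentDeriv, dS, norm_smul, norm_inv, Real.norm_eq_abs, abs_of_pos this]
  exact inv_mul_cancel₀ this.ne'

lemma inner_tangent_curvature (h : StripFlow G a b) (hz : z ∈ strip a b) :
    ⟪tangentDeriv G 0 z, tangentDeriv G 1 z⟫ = 0 := by
  have hd := h.differentiableAt_tangentDeriv 0 hz
  have h1 : EqOn (fun y => ⟪tangentDeriv G 0 y, tangentDeriv G 0 y⟫) (fun _ => (1 : ℝ))
      (strip a b) := fun y hy => by
    simp [h.norm_tangent hy]
  have h2 := dS_congr (v := flowSpeed G) (isOpen_strip a b) h1 hz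
  rw [dS_inner hd hd] at h2
  have h3 : dS (flowSpeed G) (fun _ : ℝ × ℝ => (1 : ℝ)) z = 0 := by simp [dS, dirDeriv]
  rw [h3, real_inner_comm] at h2
  have : dS (flowSpeed G) (tangentDeriv G 0) z = tangentDeriv G 1 z := rfl
  rw [this] at h2
  linarith

lemma inner_tangent_tangentDeriv_two (h : StripFlow G a b) (hz : z ∈ strip a b) :
    ⟪tangentDeriv G 0 z, tangentDeriv G 2 z⟫ = - ‖tangentDeriv G 1 z‖ ^ 2 := by
  have h1 : EqOn (fun y => ⟪tangentDeriv G 0 y, tangentDeriv G 1 y⟫) (fun _ => (0 : ℝ))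
      (strip a b) := fun y hy => h.inner_tangent_curvature hy
  have h2 := dS_congr (v := flowSpeed G) (isOpen_strip a b) h1 hz
  rw [dS_inner (h.differentiableAt_tangentDeriv 0 hz) (h.differentiableAt_tangentDeriv 1 hz)] at h2
  have h3 : dS (flowSpeed G) (fun _ : ℝ × ℝ => (0 : ℝ)) z = 0 := by simp [dS, dirDeriv]
  rw [h3] at h2
  have e1 : dS (flowSpeed G) (tangentDeriv G 0) z = tangentDeriv G 1 z := rfl
  have e2 : dS (flowSpeed G) (tangentDeriv G 1) z = tangentDeriv G 2 z := rfl
  rw [e1, e2, real_inner_self_eq_norm_sq] at h2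
  linarith

/-- The length element shrinks at the rate `κ²`. -/
lemma dT_flowSpeed (h : StripFlow G a b) (hz : z ∈ strip a b) :
    ∂ₜ (flowSpeed G) z = - (‖tangentDeriv G 1 z‖ ^ 2 * flowSpeed G z) := by
  have hU := isOpen_strip a b
  have hv := h.flowSpeed_pos hz
  have hx := contDiffOn_dirDeriv (w := ((1 : ℝ), (0 : ℝ))) hU h.smooth
  have hxd := differentiableAt_of_contDiffOn hU hx hz
  have hvd := differentiableAt_of_contDiffOn hU h.contDiffOn_flowSpeed hz
  have h1 : (fun y => flowSpeed G y * flowSpeed G y) = fun y => ⟪∂ₓ G y, ∂ₓ G y⟫ := by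
    funext y; simp [flowSpeed, sq]
  have h2 : ∂ₜ (fun y => flowSpeed G y * flowSpeed G y) z = ∂ₜ (fun y => ⟪∂ₓ G y, ∂ₓ G y⟫) z := by
    rw [h1]
  rw [dirDeriv_mul hvd hvd, dirDeriv_inner hxd hxd, real_inner_comm] at h2
  have h3 : ∂ₜ (∂ₓ G) z = flowSpeed G z • tangentDeriv G 2 z := by
    rw [dirDeriv_comm hU h.smooth hz, ← h.dX_tangentDeriv 1 hz]
    exact dirDeriv_congr hU h.flow hz
  have h4 : ∂ₓ G z = flowSpeed G z • tangentDeriv G 0 z := h.dX_eq hz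
  change flowSpeed G z * ∂ₜ (flowSpeed G) z + ∂ₜ (flowSpeed G) z * flowSpeed G z =
    ⟪∂ₓ G z, ∂ₜ (∂ₓ G) z⟫ + ⟪∂ₓ G z, ∂ₜ (∂ₓ G) z⟫ at h2
  rw [h3, h4, inner_smul_left, inner_smul_right, h.inner_tangent_tangentDeriv_two hz] at h2
  simp only [conj_trivial] at h2
  have : flowSpeed G z * ∂ₜ (flowSpeed G) z =
      flowSpeed G z * - (‖tangentDeriv G 1 z‖ ^ 2 * flowSpeed G z) := by linarith
  exact mul_left_cancel₀ hv.ne' this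

/-- The commutator of the time derivative and the arclength derivative:
`∂ₜ ∂ₛ = ∂ₛ ∂ₜ + κ² ∂ₛ`. -/
lemma dT_dS (h : StripFlow G a b) {f : ℝ × ℝ → F} (hf : ContDiffOn ℝ ∞ f (strip a b))
    (hz : z ∈ strip a b) :
    ∂ₜ (dS (flowSpeed G) f) z =
      dS (flowSpeed G) (∂ₜ f) z + ‖tangentDeriv G 1 z‖ ^ 2 • dS (flowSpeed G) f z := by
  have hU := isOpen_strip a b
  have hv := h.flowSpeed_pos hz
  have hvd := differentiableAt_of_contDiffOn hU h.contDiffOn_flowSpeed hz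
  have hfd := differentiableAt_of_contDiffOn hU (h.contDiffOn_dS hf) hz
  have h1 : EqOn (∂ₓ f) (fun y => flowSpeed G y • dS (flowSpeed G) f y) (strip a b) :=
    fun y hy => h.dX_eq hy
  have h2 := dirDeriv_congr (w := ((0 : ℝ), (1 : ℝ))) hU h1 hz
  rw [dirDeriv_smul hvd hfd, dirDeriv_comm hU hf hz] at h2
  have h3 : ∂ₓ (∂ₜ f) z = flowSpeed G z • dS (flowSpeed G) (∂ₜ f) z := h.dX_eq hz
  rw [h3] at h2
  have h4 : dirDeriv ((0 : ℝ), (1 : ℝ)) (flowSpeed G) z =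
    - (‖tangentDeriv G 1 z‖ ^ 2 * flowSpeed G z) := h.dT_flowSpeed hz
  rw [h4] at h2
  have h5 : flowSpeed G z • ∂ₜ (dS (flowSpeed G) f) z = flowSpeed G z •
      (dS (flowSpeed G) (∂ₜ f) z + ‖tangentDeriv G 1 z‖ ^ 2 • dS (flowSpeed G) f z) := by
    rw [smul_add, h2, smul_smul, neg_smul, mul_comm (flowSpeed G z)]
    abel
  exact smul_right_injective F hv.ne' h5

/-- The cubic reaction terms `⟨∂ₛᵃT, ∂ₛᵇT⟩ ∂ₛᶜT`, summed over a list of exponents `(a, b, c)`. -/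
def reaction (G : ℝ × ℝ → E) (l : List (ℕ × ℕ × ℕ)) (z : ℝ × ℝ) : E :=
  (l.map fun q => ⟪tangentDeriv G q.1 z, tangentDeriv G q.2.1 z⟫ • tangentDeriv G q.2.2 z).sum

lemma reaction_cons (q : ℕ × ℕ × ℕ) (l : List (ℕ × ℕ × ℕ)) :
    reaction G (q :: l) = fun z => ⟪tangentDeriv G q.1 z, tangentDeriv G q.2.1 z⟫ •
      tangentDeriv G q.2.2 z + reaction G l z := by
  funext z; simp [reaction]

lemma contDiffOn_reaction (h : StripFlow G a b) (l : List (ℕ × ℕ × ℕ)) :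
    ContDiffOn ℝ ∞ (reaction G l) (strip a b) := by
  induction l with
  | nil => exact contDiffOn_const
  | cons q l ih =>
    rw [reaction_cons]
    exact (((h.contDiffOn_tangentDeriv _).inner ℝ (h.contDiffOn_tangentDeriv _)).smul
      (h.contDiffOn_tangentDeriv _)).add ih

/-- The exponents of the arclength derivative of a sum of reaction terms, by the Leibniz rule. -/
def leibniz (l : List (ℕ × ℕ × ℕ)) : List (ℕ × ℕ × ℕ) :=
  l.flatMap fun q => [(q.1 + 1, q.2.1, q.2.2), (q.1, q.2.1 + 1, q.2.2), (q.1, q.2.1, q.2.2 + 1)]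

lemma dS_reaction (h : StripFlow G a b) (l : List (ℕ × ℕ × ℕ)) (hz : z ∈ strip a b) :
    dS (flowSpeed G) (reaction G l) z = reaction G (leibniz l) z := by
  have hU := isOpen_strip a b
  induction l with
  | nil =>
    have : reaction G [] = fun _ => (0 : E) := by funext z; simp [reaction]
    rw [this]
    simp [dS, dirDeriv, leibniz, reaction]
  | cons q l ih =>
    have hi : ContDiffOn ℝ ∞ (fun z => ⟪tangentDeriv G q.1 z, tangentDeriv G q.2.1 z⟫)
      (strip a b) := (h.contDiffOn_tangentDeriv _).inner ℝ (h.contDiffOn_tangentDeriv _)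
    have hid := differentiableAt_of_contDiffOn hU hi hz
    have hs : DifferentiableAt ℝ (fun z => ⟪tangentDeriv G q.1 z, tangentDeriv G q.2.1 z⟫ •
        tangentDeriv G q.2.2 z) z :=
      differentiableAt_of_contDiffOn hU (hi.smul (h.contDiffOn_tangentDeriv q.2.2)) hz
    have hr := differentiableAt_of_contDiffOn hU (h.contDiffOn_reaction l) hz
    have hd := fun m => h.differentiableAt_tangentDeriv m hz
    rw [reaction_cons, dS_add hs hr, dS_smul hid (hd _), dS_inner (hd _) (hd _), ih]
    simp [reaction, leibniz, tangentDeriv, add_smul]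
    abel

/-- The exponents of the reaction terms in the evolution equation of `∂ₛᵐT`. -/
def reactionList : ℕ → List (ℕ × ℕ × ℕ)
  | 0 => [(1, 1, 0)]
  | m + 1 => (1, 1, m + 1) :: leibniz (reactionList m)

/-- In every reaction term of the evolution equation of `∂ₛᵐT`, arclength derivatives are taken
`m + 2` times altogether, and both factors of the inner product are differentiated. -/
lemma reactionList_spec (m : ℕ) : ∀ q ∈ reactionList m,
    1 ≤ q.1 ∧ 1 ≤ q.2.1 ∧ q.1 + q.2.1 + q.2.2 = m + 2 := by
  induction m with
  | zero => simp [reactionList]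
  | succ m ih =>
    intro q hq
    simp only [reactionList, List.mem_cons, leibniz, List.mem_flatMap, List.not_mem_nil,
      or_false] at hq
    rcases hq with rfl | ⟨r, hr, rfl | rfl | rfl⟩
    · simp; omega
    all_goals
      have := ih r hr
      simp only
      omega

/-- The evolution equation `∂ₜ T⁽ᵐ⁾ = ∂ₛ² T⁽ᵐ⁾ + (cubic terms)` of the derivatives `T⁽ᵐ⁾ = ∂ₛᵐT`. -/
lemma dT_tangentDeriv (h : StripFlow G a b) (m : ℕ) : EqOn (∂ₜ (tangentDeriv G m))
    (fun z => tangentDeriv G (m + 2) z + reaction G (reactionList m) z) (strip a b) := by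
  have hU := isOpen_strip a b
  induction m with
  | zero =>
    intro z hz
    have h1 := h.dT_dS h.smooth hz
    have h2 : dS (flowSpeed G) (∂ₜ G) z = tangentDeriv G 2 z := dS_congr hU h.flow hz
    rw [h2] at h1
    simpa [reaction, reactionList, tangentDeriv, real_inner_self_eq_norm_sq] using h1
  | succ m ih =>
    intro z hz
    have h1 := h.dT_dS (h.contDiffOn_tangentDeriv m) hz
    have h2 := dS_congr (v := flowSpeed G) hU ih hz
    rw [h2, dS_add (h.differentiableAt_tangentDeriv _ hz)
      (differentiableAt_of_contDiffOn hU (h.contDiffOn_reaction _) hz), h.dS_reaction _ hz] at h1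
    rw [reactionList, reaction_cons]
    simp only [real_inner_self_eq_norm_sq]
    change ∂ₜ (tangentDeriv G (m + 1)) z = tangentDeriv G (m + 3) z + _ +
      _ • tangentDeriv G (m + 1) z at h1
    rw [h1]
    abel

end StripFlow

end Flow

/-! ### The maximum principle -/

section MaximumPrinciple

variable {F : Type*} [NormedAddCommGroup F] [NormedSpace ℝ F]

lemma hasDerivAt_fst_slice {f : ℝ × ℝ → F} {x t : ℝ} (hf : DifferentiableAt ℝ f (x, t)) :
    HasDerivAt (fun y => f (y, t)) (∂ₓ f (x, t)) x :=
  HasFDerivAt.comp_hasDerivAt x (f := fun y : ℝ => (y, t)) hf.hasFDerivAt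
    ((hasDerivAt_id x).prodMk (hasDerivAt_const x t))

lemma hasDerivAt_snd_slice {f : ℝ × ℝ → F} {x t : ℝ} (hf : DifferentiableAt ℝ f (x, t)) :
    HasDerivAt (fun s => f (x, s)) (∂ₜ f (x, t)) t :=
  HasFDerivAt.comp_hasDerivAt t (f := fun s : ℝ => (x, s)) hf.hasFDerivAt
    ((hasDerivAt_const t x).prodMk (hasDerivAt_id t))

lemma deriv_deriv_nonpos_of_isLocalMax {f : ℝ → ℝ} {x : ℝ} (h : IsLocalMax f x)
    (hc : ContinuousAt f x) : deriv (deriv f) x ≤ 0 := by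
  by_contra! hpos
  have hmin := isLocalMin_of_deriv_deriv_pos hpos h.deriv_eq_zero hc
  have hconst : f =ᶠ[𝓝 x] fun _ => f x := by
    filter_upwards [h, hmin] with y h1 h2 using le_antisymm h1 h2
  have : deriv (deriv f) x = 0 := by
    rw [hconst.deriv.deriv_eq]
    simp
  linarith

/-- A spatially periodic subsolution of `∂ₜu = ∂ₛ²u + C` grows at most at the rate `C`. -/
theorem le_add_of_subsolution {u v : ℝ × ℝ → ℝ} {a b t₀ t₁ L A C : ℝ}
    (hu : ContDiffOn ℝ ∞ u (strip a b)) (hv : ContDiffOn ℝ ∞ v (strip a b))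
    (hv0 : ∀ z ∈ strip a b, v z ≠ 0) (ha : a < t₀) (h01 : t₀ ≤ t₁) (hb : t₁ < b) (hL : 0 < L)
    (hper : ∀ z ∈ strip a b, u (z.1 + L, z.2) = u z)
    (hheat : ∀ z : ℝ × ℝ, t₀ ≤ z.2 → z.2 ≤ t₁ → ∂ₜ u z ≤ dS v (dS v u) z + C)
    (h0 : ∀ x, u (x, t₀) ≤ A) (x : ℝ) : u (x, t₁) ≤ A + C * (t₁ - t₀) := by
  have hU := isOpen_strip a b
  have hmem : ∀ z : ℝ × ℝ, t₀ ≤ z.2 → z.2 ≤ t₁ → z ∈ strip a b := fun z h1 h2 =>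
    mem_strip.2 ⟨by linarith, by linarith⟩
  suffices H : ∀ ε > 0, u (x, t₁) ≤ A + (C + ε) * (t₁ - t₀) by
    have h1 : Tendsto (fun ε : ℝ => A + (C + ε) * (t₁ - t₀)) (𝓝[>] 0)
        (𝓝 (A + (C + 0) * (t₁ - t₀))) := by
      apply tendsto_nhdsWithin_of_tendsto_nhds
      apply Continuous.tendsto
      fun_prop
    rw [add_zero] at h1
    exact ge_of_tendsto h1 (by filter_upwards [self_mem_nhdsWithin] with ε hε using H ε hε)
  intro ε hε
  -- Subtracting a slightly larger linear growth makes the differential inequality strict.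
  set g : ℝ × ℝ → ℝ := fun z => u z - (C + ε) * (z.2 - t₀) with hg
  have hK : IsCompact (Icc 0 L ×ˢ Icc t₀ t₁) := isCompact_Icc.prod isCompact_Icc
  have hcont : ContinuousOn g (Icc 0 L ×ˢ Icc t₀ t₁) := by
    refine ContinuousOn.sub (hu.continuousOn.mono ?_) (by fun_prop)
    exact fun z hz => hmem z hz.2.1 hz.2.2
  obtain ⟨⟨x₀, s⟩, hzK, hmax⟩ := hK.exists_isMaxOn ⟨(0, t₀), by simp [hL.le, h01]⟩ hcont
  obtain ⟨hs0, hs1⟩ : t₀ ≤ s ∧ s ≤ t₁ := hzK.2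
  have hglob : ∀ y r, t₀ ≤ r → r ≤ t₁ → g (y, r) ≤ g (x₀, s) := by
    intro y r h1 h2
    have hp : Function.Periodic (fun y => u (y, r)) L := fun y => hper (y, r) (hmem _ h1 h2)
    obtain ⟨y', hy', he⟩ := hp.exists_mem_Ico₀ hL y
    have he' : u (y, r) = u (y', r) := he
    have h3 : g (y', r) ≤ g (x₀, s) := hmax (show (y', r) ∈ _ from ⟨⟨hy'.1, hy'.2.le⟩, h1, h2⟩)
    simpa [hg, he'] using h3
  have hfin := hglob x t₁ h01 le_rfl
  rcases hs0.eq_or_lt with rfl | hlt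
  · simp only [hg, sub_self, mul_zero, sub_zero] at hfin
    linarith [h0 x₀]
  exfalso
  have hz : (x₀, s) ∈ strip a b := hmem _ hs0 hs1
  have hud := fun y => differentiableAt_of_contDiffOn hU hu (hmem (y, s) hs0 hs1)
  have hux := contDiffOn_dirDeriv (w := ((1 : ℝ), (0 : ℝ))) hU hu
  have hlocmax : IsLocalMax (fun y => u (y, s)) x₀ := by
    refine Eventually.of_forall fun y => ?_
    have := hglob y s hs0 hs1
    simp only [hg] at this
    simpa using this
  have hd1 : deriv (fun y => u (y, s)) = fun y => ∂ₓ u (y, s) := by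
    funext y; exact (hasDerivAt_fst_slice (hud y)).deriv
  have hx0 : ∂ₓ u (x₀, s) = 0 := by
    have := hlocmax.deriv_eq_zero
    rwa [hd1] at this
  have hxx : ∂ₓ (∂ₓ u) (x₀, s) ≤ 0 := by
    have := deriv_deriv_nonpos_of_isLocalMax hlocmax
      (hasDerivAt_fst_slice (hud x₀)).continuousAt
    rw [hd1] at this
    rwa [(hasDerivAt_fst_slice (differentiableAt_of_contDiffOn hU hux hz)).deriv] at this
  have hss : dS v (dS v u) (x₀, s) ≤ 0 := by
    have hvi : DifferentiableAt ℝ (fun y => (v y)⁻¹) (x₀, s) := differentiableAt_of_contDiffOn hU (hv.inv hv0) hz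
    have h1 : dS v (dS v u) (x₀, s) = (v (x₀, s))⁻¹ *
        ∂ₓ (fun y => (v y)⁻¹ • ∂ₓ u y) (x₀, s) := rfl
    rw [h1, dirDeriv_smul hvi (differentiableAt_of_contDiffOn hU hux hz), hx0, smul_zero, add_zero,
      smul_eq_mul, ← mul_assoc]
    exact mul_nonpos_of_nonneg_of_nonpos (mul_self_nonneg _) hxx
  have hslope : HasDerivAt (fun r => g (x₀, r)) (∂ₜ u (x₀, s) - (C + ε) * 1) s :=
    (hasDerivAt_snd_slice (hud x₀)).sub (((hasDerivAt_id s).sub_const t₀).const_mul (C + ε))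
  have hnonneg : 0 ≤ ∂ₜ u (x₀, s) - (C + ε) * 1 := by
    have h1 := (hasDerivWithinAt_iff_tendsto_slope' (s := Iio s) (by simp)).1
      hslope.hasDerivWithinAt
    refine ge_of_tendsto h1 ?_
    filter_upwards [Ioo_mem_nhdsLT hlt] with r hr
    rw [slope_def_field]
    have := hglob x₀ r hr.1.le (by linarith [hr.2])
    exact div_nonneg_of_nonpos (by linarith) (by linarith [hr.2])
  have := hheat (x₀, s) hs0 hs1
  linarith

end MaximumPrinciple

/-! ### Interior estimates for the derivatives of the curvature -/

section Estimates

variable {F : Type*} [NormedAddCommGroup F] [NormedSpace ℝ F]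
variable {E : Type*} [NormedAddCommGroup E] [InnerProductSpace ℝ E]

/-- Periodicity in the curve parameter, at all times in `(a, b)`. -/
def StripPeriodic (f : ℝ × ℝ → F) (a b L : ℝ) : Prop :=
  ∀ z ∈ strip a b, f (z.1 + L, z.2) = f z

lemma StripPeriodic.dX {f : ℝ × ℝ → F} {a b L : ℝ} (hf : StripPeriodic f a b L) :
    StripPeriodic (∂ₓ f) a b L := by
  intro z hz
  have h1 : EqOn (fun y => f (y + (L, 0))) f (strip a b) := fun y hy => by
    simpa [Prod.add_def] using hf y hy
  have h2 := dirDeriv_congr (w := ((1 : ℝ), (0 : ℝ))) (isOpen_strip a b) h1 hz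
  simp only [dirDeriv, fderiv_comp_add_right] at h2
  simpa [dirDeriv, Prod.add_def] using h2

namespace StripFlow

variable {G : ℝ × ℝ → E} {a b L : ℝ} {z : ℝ × ℝ}

lemma stripPeriodic_tangentDeriv (hG : StripPeriodic G a b L) (m : ℕ) :
    StripPeriodic (tangentDeriv G m) a b L := by
  have hv : StripPeriodic (flowSpeed G) a b L := fun z hz => by simp [flowSpeed, hG.dX z hz]
  induction m with
  | zero => exact fun z hz => by simp [tangentDeriv, dS, hG.dX z hz, hv z hz]
  | succ m ih => exact fun z hz => by simp [tangentDeriv, dS, ih.dX z hz, hv z hz]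

/-- `|∂ₛᵐT|²`. -/
def sqDeriv (G : ℝ × ℝ → E) (m : ℕ) (z : ℝ × ℝ) : ℝ := ⟪tangentDeriv G m z, tangentDeriv G m z⟫

lemma sqDeriv_eq (m : ℕ) (z : ℝ × ℝ) : sqDeriv G m z = ‖tangentDeriv G m z‖ ^ 2 :=
  real_inner_self_eq_norm_sq _

lemma contDiffOn_sqDeriv (h : StripFlow G a b) (m : ℕ) :
    ContDiffOn ℝ ∞ (sqDeriv G m) (strip a b) :=
  (h.contDiffOn_tangentDeriv m).inner ℝ (h.contDiffOn_tangentDeriv m)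

/-- The reaction-diffusion equation of `|∂ₛᵐT|²`, with its good gradient term `-2 |∂ₛᵐ⁺¹T|²`. -/
lemma dT_sqDeriv (h : StripFlow G a b) (m : ℕ) (hz : z ∈ strip a b) :
    ∂ₜ (sqDeriv G m) z = dS (flowSpeed G) (dS (flowSpeed G) (sqDeriv G m)) z
      - 2 * sqDeriv G (m + 1) z
      + 2 * ⟪tangentDeriv G m z, reaction G (reactionList m) z⟫ := by
  have hU := isOpen_strip a b
  have hd := fun m y hy => h.differentiableAt_tangentDeriv (z := y) m hy
  have h1 : EqOn (dS (flowSpeed G) (sqDeriv G m)) (fun y =>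
      ⟪tangentDeriv G (m + 1) y, tangentDeriv G m y⟫ +
      ⟪tangentDeriv G m y, tangentDeriv G (m + 1) y⟫) (strip a b) := fun y hy =>
    dS_inner (hd m y hy) (hd m y hy)
  have hi1 := differentiableAt_of_contDiffOn hU
    ((h.contDiffOn_tangentDeriv (m + 1)).inner ℝ (h.contDiffOn_tangentDeriv m)) hz
  have hi2 := differentiableAt_of_contDiffOn hU
    ((h.contDiffOn_tangentDeriv m).inner ℝ (h.contDiffOn_tangentDeriv (m + 1))) hz
  rw [dS_congr hU h1 hz, dS_add hi1 hi2, dS_inner (hd _ z hz) (hd _ z hz),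
    dS_inner (hd _ z hz) (hd _ z hz)]
  have h2 : ∂ₜ (sqDeriv G m) z = ⟪∂ₜ (tangentDeriv G m) z, tangentDeriv G m z⟫ +
      ⟪tangentDeriv G m z, ∂ₜ (tangentDeriv G m) z⟫ := dirDeriv_inner (hd m z hz) (hd m z hz)
  rw [h2, h.dT_tangentDeriv m hz]
  have e1 : dS (flowSpeed G) (tangentDeriv G m) z = tangentDeriv G (m + 1) z := rfl
  have e2 : dS (flowSpeed G) (tangentDeriv G (m + 1)) z = tangentDeriv G (m + 2) z := rfl
  simp only [e1, e2, inner_add_left, inner_add_right, sqDeriv]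
  rw [real_inner_comm (tangentDeriv G m z) (tangentDeriv G (m + 2) z),
    real_inner_comm (tangentDeriv G m z) (reaction G _ z)]
  ring

lemma inner_reaction_le {X : E} {K : ℝ} (l : List (ℕ × ℕ × ℕ))
    (hl : ∀ q ∈ l, ⟪X, ⟪tangentDeriv G q.1 z, tangentDeriv G q.2.1 z⟫ • tangentDeriv G q.2.2 z⟫ ≤ K) :
    ⟪X, reaction G l z⟫ ≤ l.length * K := by
  induction l with
  | nil => simp [reaction]
  | cons q l ih =>
    rw [reaction_cons, inner_add_right]
    have h1 := hl q (by simp)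
    have h2 := ih fun q hq => hl q (by simp [hq])
    simp only [List.length_cons, Nat.cast_add, Nat.cast_one]
    linarith

lemma inner_cubic_le (X A B D : E) : ⟪X, ⟪A, B⟫ • D⟫ ≤ ‖X‖ * ‖A‖ * ‖B‖ * ‖D‖ := by
  refine (real_inner_le_norm _ _).trans ?_
  rw [norm_smul, mul_assoc, mul_assoc, ← mul_assoc ‖A‖]
  gcongr
  exact norm_inner_le_norm A B

/-- If all derivatives up to the order `m` are bounded, the reaction term in the evolution of
`|∂ₛᵐT|²` grows at most linearly in `∂ₛᵐ⁺¹T`. -/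
lemma inner_reaction_le_linear {C : ℝ} (hC : 1 ≤ C) {m : ℕ} (hm : 1 ≤ m)
    (hb : ∀ i ≤ m, ‖tangentDeriv G i z‖ ≤ C) :
    ⟪tangentDeriv G m z, reaction G (reactionList m) z⟫ ≤
      (reactionList m).length * (C ^ 4 * (1 + ‖tangentDeriv G (m + 1) z‖)) := by
  refine inner_reaction_le _ fun q hq => (inner_cubic_le _ _ _ _).trans ?_
  obtain ⟨h1, h2, h3⟩ := reactionList_spec m q hq
  have hy := norm_nonneg (tangentDeriv G (m + 1) z)
  have hC0 : 0 ≤ C := by linarith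
  have hp : 0 ≤ C ^ 4 := by positivity
  have hc : q.2.2 ≤ m := by omega
  have hm' := hb m le_rfl
  have hc' := hb _ hc
  have hlow : C ^ 3 ≤ C ^ 4 := pow_le_pow_right₀ hC (by norm_num)
  rcases Nat.lt_or_ge m q.1 with ha | ha
  · have ea : q.1 = m + 1 := by omega
    have eb : q.2.1 ≤ m := by omega
    rw [ea]
    calc ‖tangentDeriv G m z‖ * ‖tangentDeriv G (m + 1) z‖ * ‖tangentDeriv G q.2.1 z‖ *
          ‖tangentDeriv G q.2.2 z‖ ≤ C * ‖tangentDeriv G (m + 1) z‖ * C * C := by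
          gcongr; exact hb _ eb
      _ = C ^ 3 * ‖tangentDeriv G (m + 1) z‖ := by ring
      _ ≤ C ^ 4 * (1 + ‖tangentDeriv G (m + 1) z‖) := by gcongr; linarith
  · rcases Nat.lt_or_ge m q.2.1 with hb' | hb'
    · have eb : q.2.1 = m + 1 := by omega
      rw [eb]
      calc ‖tangentDeriv G m z‖ * ‖tangentDeriv G q.1 z‖ * ‖tangentDeriv G (m + 1) z‖ *
            ‖tangentDeriv G q.2.2 z‖ ≤ C * C * ‖tangentDeriv G (m + 1) z‖ * C := by
            gcongr; exact hb _ ha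
        _ = C ^ 3 * ‖tangentDeriv G (m + 1) z‖ := by ring
        _ ≤ C ^ 4 * (1 + ‖tangentDeriv G (m + 1) z‖) := by gcongr; linarith
    · calc ‖tangentDeriv G m z‖ * ‖tangentDeriv G q.1 z‖ * ‖tangentDeriv G q.2.1 z‖ *
            ‖tangentDeriv G q.2.2 z‖ ≤ C * C * C * C := by
            gcongr
            · exact hb _ ha
            · exact hb _ hb'
        _ = C ^ 4 * 1 := by ring
        _ ≤ C ^ 4 * (1 + ‖tangentDeriv G (m + 1) z‖) := by gcongr; linarith

/-- If all derivatives up to the order `m ≥ 1` are bounded, the reaction term in the evolution of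
`|∂ₛᵐ⁺¹T|²` is at most quadratic. For `m = 1` this rests on `⟨T, ∂ₛ²T⟩ = -κ²`, which turns the
cubic term `|∂ₛ²T|² ⟨T, ∂ₛ²T⟩` into a quadratic one. -/
lemma inner_reaction_le_quadratic (h : StripFlow G a b) (hz : z ∈ strip a b) {C : ℝ} (hC : 1 ≤ C)
    {m : ℕ} (hm : 1 ≤ m) (hb : ∀ i ≤ m, ‖tangentDeriv G i z‖ ≤ C) :
    ⟪tangentDeriv G (m + 1) z, reaction G (reactionList (m + 1)) z⟫ ≤
      (reactionList (m + 1)).length * (C ^ 4 * (1 + ‖tangentDeriv G (m + 1) z‖ ^ 2 +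
        ‖tangentDeriv G (m + 1) z‖ * ‖tangentDeriv G (m + 2) z‖)) := by
  refine inner_reaction_le _ fun q hq => ?_
  obtain ⟨h1, h2, h3⟩ := reactionList_spec (m + 1) q hq
  set y := ‖tangentDeriv G (m + 1) z‖ with hy_def
  set w := ‖tangentDeriv G (m + 2) z‖ with hw_def
  have hy : 0 ≤ y := norm_nonneg _
  have hw : 0 ≤ w := norm_nonneg _
  have hC0 : 0 ≤ C := by linarith
  have hC2 : C ^ 2 ≤ C ^ 4 := pow_le_pow_right₀ hC (by norm_num)
  have hC3 : C ^ 3 ≤ C ^ 4 := pow_le_pow_right₀ hC (by norm_num)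
  have hyw : 0 ≤ y * w := mul_nonneg hy hw
  have hquad : C ^ 2 * (y * w) ≤ C ^ 4 * (1 + y ^ 2 + y * w) := by
    gcongr; nlinarith
  have hquad2 : C ^ 2 * y ^ 2 ≤ C ^ 4 * (1 + y ^ 2 + y * w) := by
    gcongr; linarith
  have hquad3 : C ^ 3 * y ≤ C ^ 4 * (1 + y ^ 2 + y * w) := by
    gcongr; nlinarith [sq_nonneg (y - 1)]
  have hcub := inner_cubic_le (tangentDeriv G (m + 1) z) (tangentDeriv G q.1 z)
    (tangentDeriv G q.2.1 z) (tangentDeriv G q.2.2 z)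
  rcases Nat.lt_or_ge (m + 1) q.1 with ha | ha
  · have ea : q.1 = m + 2 := by omega
    rw [ea] at hcub ⊢
    refine hcub.trans (le_trans ?_ hquad)
    calc y * w * ‖tangentDeriv G q.2.1 z‖ * ‖tangentDeriv G q.2.2 z‖ ≤ y * w * C * C := by
          gcongr
          · exact hb _ (by omega)
          · exact hb _ (by omega)
      _ = C ^ 2 * (y * w) := by ring
  rcases Nat.lt_or_ge (m + 1) q.2.1 with hb' | hb'
  · have eb : q.2.1 = m + 2 := by omega
    rw [eb] at hcub ⊢
    refine hcub.trans (le_trans ?_ hquad)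
    calc y * ‖tangentDeriv G q.1 z‖ * w * ‖tangentDeriv G q.2.2 z‖ ≤ y * C * w * C := by
          gcongr
          · exact hb _ (by omega)
          · exact hb _ (by omega)
      _ = C ^ 2 * (y * w) := by ring
  rcases ha.eq_or_lt with ea | ha
  · rcases hb'.eq_or_lt with eb | hb'
    · obtain rfl : m = 1 := by omega
      have ec : q.2.2 = 0 := by omega
      rw [ea, eb, ec, inner_smul_right, real_inner_comm (tangentDeriv G 0 z),
        h.inner_tangent_tangentDeriv_two hz]
      refine le_trans ?_ hquad2
      have : 0 ≤ ⟪tangentDeriv G 2 z, tangentDeriv G 2 z⟫ := real_inner_self_nonneg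
      have h5 : 0 ≤ C ^ 2 * y ^ 2 := by positivity
      nlinarith [sq_nonneg ‖tangentDeriv G 1 z‖]
    · rw [ea] at hcub ⊢
      refine hcub.trans (le_trans ?_ hquad2)
      calc y * y * ‖tangentDeriv G q.2.1 z‖ * ‖tangentDeriv G q.2.2 z‖ ≤ y * y * C * C := by
            gcongr
            · exact hb _ (by omega)
            · exact hb _ (by omega)
        _ = C ^ 2 * y ^ 2 := by ring
  rcases hb'.eq_or_lt with eb | hb'
  · rw [eb] at hcub ⊢
    refine hcub.trans (le_trans ?_ hquad2)
    calc y * ‖tangentDeriv G q.1 z‖ * y * ‖tangentDeriv G q.2.2 z‖ ≤ y * C * y * C := by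
          gcongr
          · exact hb _ (by omega)
          · exact hb _ (by omega)
      _ = C ^ 2 * y ^ 2 := by ring
  rcases Nat.lt_or_ge m q.2.2 with hc | hc
  · have ec : q.2.2 = m + 1 := by omega
    rw [ec] at hcub ⊢
    refine hcub.trans (le_trans ?_ hquad2)
    calc y * ‖tangentDeriv G q.1 z‖ * ‖tangentDeriv G q.2.1 z‖ * y ≤ y * C * C * y := by
          gcongr
          · exact hb _ (by omega)
          · exact hb _ (by omega)
      _ = C ^ 2 * y ^ 2 := by ring
  · refine hcub.trans (le_trans ?_ hquad3)
    calc y * ‖tangentDeriv G q.1 z‖ * ‖tangentDeriv G q.2.1 z‖ * ‖tangentDeriv G q.2.2 z‖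
        ≤ y * C * C * C := by
          gcongr
          · exact hb _ (by omega)
          · exact hb _ (by omega)
          · exact hb _ (by omega)
      _ = C ^ 3 * y := by ring

/-- Bernstein's trick: if the derivatives of the unit tangent up to the order `m ≥ 1` are bounded
on a time interval of length one, then at its end the next derivative is bounded by a constant
that does not depend on the flow. It is the maximum principle for
`(t - t₀) |∂ₛᵐ⁺¹T|² + B |∂ₛᵐT|²` with a large constant `B`. -/
lemma exists_bound_next_tangentDeriv (E : Type*) [NormedAddCommGroup E] [InnerProductSpace ℝ E]
    (C : ℝ) (hC : 1 ≤ C) (m : ℕ) (hm : 1 ≤ m) : ∃ C' : ℝ, ∀ (G : ℝ × ℝ → E) (a b L t₀ : ℝ),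
      StripFlow G a b → StripPeriodic G a b L → 0 < L → a < t₀ → t₀ + 1 < b →
      (∀ z : ℝ × ℝ, t₀ ≤ z.2 → z.2 ≤ t₀ + 1 → ∀ i ≤ m, ‖tangentDeriv G i z‖ ≤ C) →
      ∀ x, ‖tangentDeriv G (m + 1) (x, t₀ + 1)‖ ≤ C' := by
  set K₀ : ℝ := 2 * ((reactionList (m + 1)).length * C ^ 4) with hK₀
  set K₁ : ℝ := 2 * ((reactionList m).length * C ^ 4) with hK₁
  have hC0 : 0 ≤ C := by linarith
  have hK₀' : 0 ≤ K₀ := by positivity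
  have hK₁' : 0 ≤ K₁ := by positivity
  set K := K₀ + K₀ ^ 2 with hK
  have hK' : 0 ≤ K := by positivity
  set B := 1 + K with hB
  have hB' : 0 ≤ B := by positivity
  set R := B * C ^ 2 + (K + B * (K₁ + K₁ ^ 2)) with hR
  refine ⟨1 + R, fun G a b L t₀ h hper hL ha hb hbound x => ?_⟩
  have hU := isOpen_strip a b
  have hmem : ∀ z : ℝ × ℝ, t₀ ≤ z.2 → z.2 ≤ t₀ + 1 → z ∈ strip a b := fun z h1 h2 =>
    mem_strip.2 ⟨by linarith, by linarith⟩
  set u : ℝ × ℝ → ℝ := fun z => (z.2 - t₀) * sqDeriv G (m + 1) z + B * sqDeriv G m z with hu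
  have hs := h.contDiffOn_sqDeriv
  have hτ : ContDiff ℝ ∞ fun z : ℝ × ℝ => z.2 - t₀ := by fun_prop
  have hu_smooth : ContDiffOn ℝ ∞ u (strip a b) :=
    (hτ.contDiffOn.mul (hs (m + 1))).add (contDiffOn_const.mul (hs m))
  have hτd : ∀ z : ℝ × ℝ, DifferentiableAt ℝ (fun z : ℝ × ℝ => z.2 - t₀) z := fun z => by fun_prop
  have hdir : ∀ (w z : ℝ × ℝ), z ∈ strip a b → dirDeriv w u z =
      (z.2 - t₀) * dirDeriv w (sqDeriv G (m + 1)) z + w.2 * sqDeriv G (m + 1) z +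
        B * dirDeriv w (sqDeriv G m) z := by
    intro w z hz
    have d1 := differentiableAt_of_contDiffOn hU (hs (m + 1)) hz
    have d2 := differentiableAt_of_contDiffOn hU (hs m) hz
    have e1 : dirDeriv w (fun z : ℝ × ℝ => z.2 - t₀) z = w.2 := by
      simp [dirDeriv, fderiv_sub_const, fderiv_snd]
    have e2 : dirDeriv w (fun _ : ℝ × ℝ => B) z = 0 := by simp [dirDeriv]
    rw [hu, dirDeriv_add ((hτd z).fun_mul d1) ((differentiableAt_const B).fun_mul d2),
      dirDeriv_mul (hτd z) d1, dirDeriv_mul (differentiableAt_const B) d2, e1, e2]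
    ring
  have hdS : EqOn (dS (flowSpeed G) u) (fun z =>
      (z.2 - t₀) * dS (flowSpeed G) (sqDeriv G (m + 1)) z +
        B * dS (flowSpeed G) (sqDeriv G m) z) (strip a b) := fun z hz => by
    simp only [dS, smul_eq_mul, hdir _ z hz]
    ring
  have hdS2 : EqOn (dS (flowSpeed G) (dS (flowSpeed G) u)) (fun z =>
      (z.2 - t₀) * dS (flowSpeed G) (dS (flowSpeed G) (sqDeriv G (m + 1))) z +
        B * dS (flowSpeed G) (dS (flowSpeed G) (sqDeriv G m)) z) (strip a b) := fun z hz => by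
    rw [dS_congr hU hdS hz]
    have d1 := differentiableAt_of_contDiffOn hU (h.contDiffOn_dS (hs (m + 1))) hz
    have d2 := differentiableAt_of_contDiffOn hU (h.contDiffOn_dS (hs m)) hz
    have e1 : ∂ₓ (fun z : ℝ × ℝ => z.2 - t₀) z = 0 := by
      simp [dirDeriv, fderiv_sub_const, fderiv_snd]
    have e2 : ∂ₓ (fun _ : ℝ × ℝ => B) z = 0 := by simp [dirDeriv]
    rw [dS_add ((hτd z).fun_mul d1) ((differentiableAt_const B).fun_mul d2)]
    have f1 := dirDeriv_mul (w := ((1 : ℝ), (0 : ℝ))) (hτd z) d1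
    have f2 := dirDeriv_mul (w := ((1 : ℝ), (0 : ℝ))) (differentiableAt_const B) d2
    rw [e1] at f1
    rw [e2] at f2
    have g1 : ∀ k, dS (flowSpeed G) (dS (flowSpeed G) (sqDeriv G k)) z =
        (flowSpeed G z)⁻¹ * ∂ₓ (dS (flowSpeed G) (sqDeriv G k)) z := fun _ => rfl
    rw [dS, dS, f1, f2]
    simp only [smul_eq_mul, g1]
    ring
  have hperT := fun m => stripPeriodic_tangentDeriv hper m
  have main := le_add_of_subsolution (u := u) (v := flowSpeed G) (t₀ := t₀) (t₁ := t₀ + 1)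
    (A := B * C ^ 2) (C := K + B * (K₁ + K₁ ^ 2)) hu_smooth h.contDiffOn_flowSpeed
    (fun z hz => (h.flowSpeed_pos hz).ne') ha (by linarith) hb hL ?_ ?_ ?_ x
  · simp only [hu, sqDeriv_eq] at main
    have h0 := mul_nonneg hB' (sq_nonneg ‖tangentDeriv G m (x, t₀ + 1)‖)
    have h1 : ‖tangentDeriv G (m + 1) (x, t₀ + 1)‖ ^ 2 ≤ R := by
      rw [hR]; linarith
    nlinarith [sq_nonneg (‖tangentDeriv G (m + 1) (x, t₀ + 1)‖ - 1),
      norm_nonneg (tangentDeriv G (m + 1) (x, t₀ + 1))]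
  · intro z hz
    simp only [hu, sqDeriv, hperT _ z hz]
  · intro z hz0 hz1
    have hz := hmem z hz0 hz1
    have hbz := hbound z hz0 hz1
    have q1 := inner_reaction_le_linear hC hm hbz
    have q2 := inner_reaction_le_quadratic h hz hC hm hbz
    rw [hdS2 hz, hdir _ z hz, h.dT_sqDeriv _ hz, h.dT_sqDeriv _ hz]
    simp only [sqDeriv_eq]
    set y := ‖tangentDeriv G (m + 1) z‖ with hy
    set w := ‖tangentDeriv G (m + 1 + 1) z‖ with hw
    have q1' : 2 * ⟪tangentDeriv G m z, reaction G (reactionList m) z⟫ ≤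
        y ^ 2 + (K₁ + K₁ ^ 2) := by
      have : 2 * ⟪tangentDeriv G m z, reaction G (reactionList m) z⟫ ≤ K₁ * (1 + y) := by
        rw [hK₁]; linarith
      nlinarith [sq_nonneg (y - K₁), sq_nonneg y, sq_nonneg K₁]
    have q2' : 2 * ⟪tangentDeriv G (m + 1) z, reaction G (reactionList (m + 1)) z⟫ ≤
        2 * w ^ 2 + K * (1 + y ^ 2) := by
      have h1 : 2 * ⟪tangentDeriv G (m + 1) z, reaction G (reactionList (m + 1)) z⟫ ≤
          K₀ * (1 + y ^ 2 + y * w) := by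
        rw [hK₀]; linarith
      have h2 : K₀ * (y * w) ≤ 2 * w ^ 2 + K₀ ^ 2 * y ^ 2 := by
        nlinarith [sq_nonneg (w - K₀ * y), sq_nonneg w, sq_nonneg (K₀ * y)]
      rw [hK]
      nlinarith [sq_nonneg K₀]
    have hd0 : 0 ≤ z.2 - t₀ := by linarith
    have hd1 : z.2 - t₀ ≤ 1 := by linarith
    have r1 : (z.2 - t₀) * (2 * ⟪tangentDeriv G (m + 1) z, reaction G (reactionList (m + 1)) z⟫
        - 2 * w ^ 2) ≤ K * (1 + y ^ 2) := by
      have h1 : (z.2 - t₀) * (2 * ⟪tangentDeriv G (m + 1) z, reaction G (reactionList (m + 1)) z⟫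
        - 2 * w ^ 2) ≤ (z.2 - t₀) * (K * (1 + y ^ 2)) := by
        gcongr; linarith
      have h2 : (z.2 - t₀) * (K * (1 + y ^ 2)) ≤ 1 * (K * (1 + y ^ 2)) := by gcongr
      linarith
    have r2 : B * (2 * ⟪tangentDeriv G m z, reaction G (reactionList m) z⟫ - 2 * y ^ 2) ≤
        B * (- y ^ 2 + (K₁ + K₁ ^ 2)) := by
      gcongr; linarith
    rw [hB] at r2 ⊢
    linarith
  · intro x
    have := hbound (x, t₀) le_rfl (by simp) m le_rfl
    simp only [hu, sqDeriv_eq, sub_self, zero_mul, zero_add]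
    gcongr

/-- A bound for the curvature on the time interval `(a, 0]` bounds the `m`-th derivative of the
curvature on `(a + m, 0]`, by a constant that depends only on `m` and on the bound. -/
theorem exists_bound_tangentDeriv (E : Type*) [NormedAddCommGroup E] [InnerProductSpace ℝ E]
    (M : ℝ) (m : ℕ) : ∃ C : ℝ, 1 ≤ C ∧ ∀ (G : ℝ × ℝ → E) (a b L : ℝ),
      StripFlow G a b → StripPeriodic G a b L → 0 < L → 0 < b →
      (∀ z : ℝ × ℝ, a < z.2 → z.2 ≤ 0 → ‖tangentDeriv G 1 z‖ ^ 2 ≤ M) →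
      ∀ z : ℝ × ℝ, a + m < z.2 → z.2 ≤ 0 → ∀ i ≤ m + 1, ‖tangentDeriv G i z‖ ≤ C := by
  induction m with
  | zero =>
    refine ⟨1 + |M|, by linarith [abs_nonneg M], ?_⟩
    intro G a b L h hper hL hb hM z hz0 hz1 i hi
    simp only [Nat.cast_zero, add_zero] at hz0
    have hz : z ∈ strip a b := mem_strip.2 ⟨hz0, by linarith⟩
    interval_cases i
    · rw [h.norm_tangent hz]; linarith [abs_nonneg M]
    · have h1 := (hM z hz0 hz1).trans (le_abs_self M)
      nlinarith [sq_nonneg (‖tangentDeriv G 1 z‖ - 1)]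
  | succ m ih =>
    obtain ⟨C, hC, hbd⟩ := ih
    obtain ⟨C', hC'⟩ := exists_bound_next_tangentDeriv E C hC (m + 1) (by omega)
    refine ⟨max C C', le_max_of_le_left hC, ?_⟩
    intro G a b L h hper hL hb hM z hz0 hz1 i hi
    push_cast at hz0
    rcases hi.eq_or_lt with rfl | hi
    · refine le_max_of_le_right ?_
      have := hC' G a b L (z.2 - 1) h hper hL
        (by have : (0 : ℝ) ≤ m := Nat.cast_nonneg m
            linarith) (by linarith) (fun y hy0 hy1 =>
          hbd G a b L h hper hL hb hM y (by linarith) (by linarith)) z.1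
      simpa using this
    · exact le_max_of_le_left (hbd G a b L h hper hL hb hM z (by linarith) hz1 i (by omega))

end StripFlow

end Estimates

/-! ### Sequences of functions that are bounded with all derivatives -/

section LocallyBounded

variable {F : Type*} [NormedAddCommGroup F]

/-- The compact set `[-R, R] × [-R, 0]`. These sets exhaust `ℝ × (-∞, 0]`. -/
def slab (R : ℝ) : Set (ℝ × ℝ) := Icc (-R) R ×ˢ Icc (-R) 0

/-- Eventual boundedness, on each compact subset of `ℝ × (-∞, 0]`, of a sequence of functions. -/
def LocBdd (f : ℕ → ℝ × ℝ → F) : Prop :=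
  ∀ R : ℝ, ∃ C : ℝ, ∀ᶠ j in atTop, ∀ z ∈ slab R, ‖f j z‖ ≤ C

/-- The strips `ℝ × (a j, b j)` contain `0` in their time intervals and exhaust the past. -/
structure ExhaustPast (a b : ℕ → ℝ) : Prop where
  neg : ∀ j, a j < 0
  pos : ∀ j, 0 < b j
  lim : Tendsto a atTop atBot

variable {a b : ℕ → ℝ}

lemma ExhaustPast.slab_subset (h : ExhaustPast a b) (R : ℝ) :
    ∀ᶠ j in atTop, slab R ⊆ strip (a j) (b j) := by
  filter_upwards [h.lim.eventually_lt_atBot (-R)] with j hj z hz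
  exact mem_strip.2 ⟨hj.trans_le hz.2.1, hz.2.2.trans_lt (h.pos j)⟩

lemma LocBdd.congr (h : ExhaustPast a b) {f g : ℕ → ℝ × ℝ → F} (hg : LocBdd g)
    (hfg : ∀ j, EqOn (f j) (g j) (strip (a j) (b j))) : LocBdd f := by
  intro R
  obtain ⟨C, hC⟩ := hg R
  refine ⟨C, ?_⟩
  filter_upwards [hC, h.slab_subset R] with j h1 h2 z hz
  rw [hfg j (h2 hz)]
  exact h1 z hz

lemma LocBdd.add {f g : ℕ → ℝ × ℝ → F} (hf : LocBdd f) (hg : LocBdd g) :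
    LocBdd fun j z => f j z + g j z := by
  intro R
  obtain ⟨C, hC⟩ := hf R
  obtain ⟨D, hD⟩ := hg R
  refine ⟨C + D, ?_⟩
  filter_upwards [hC, hD] with j h1 h2 z hz
  exact (norm_add_le _ _).trans (add_le_add (h1 z hz) (h2 z hz))

lemma LocBdd.mul {f g : ℕ → ℝ × ℝ → ℝ} (hf : LocBdd f) (hg : LocBdd g) :
    LocBdd fun j z => f j z * g j z := by
  intro R
  obtain ⟨C, hC⟩ := hf R
  obtain ⟨D, hD⟩ := hg R
  refine ⟨C * D, ?_⟩
  filter_upwards [hC, hD] with j h1 h2 z hz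
  rw [norm_mul]
  exact mul_le_mul (h1 z hz) (h2 z hz) (norm_nonneg _) ((norm_nonneg _).trans (h1 z hz))

lemma LocBdd.of_le {H : Type*} [NormedAddCommGroup H] {f : ℕ → ℝ × ℝ → F} {g : ℕ → ℝ × ℝ → H}
    (hg : LocBdd g) (c : ℝ) (hc : 0 ≤ c) (hfg : ∀ j z, ‖f j z‖ ≤ c * ‖g j z‖) : LocBdd f := by
  intro R
  obtain ⟨C, hC⟩ := hg R
  refine ⟨c * C, ?_⟩
  filter_upwards [hC] with j h1 z hz
  exact (hfg j z).trans (mul_le_mul_of_nonneg_left (h1 z hz) hc)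

/-- Bounds at time `0` propagate to all nonpositive times if the time derivative is locally bounded. -/
lemma LocBdd.of_dT [NormedSpace ℝ F] (h : ExhaustPast a b) {f : ℕ → ℝ × ℝ → F}
    (hf : ∀ j, ContDiffOn ℝ ∞ (f j) (strip (a j) (b j)))
    (hinit : ∀ R : ℝ, ∃ C : ℝ, ∀ᶠ j in atTop, ∀ x ∈ Icc (-R) R, ‖f j (x, 0)‖ ≤ C)
    (hd : LocBdd fun j => ∂ₜ (f j)) : LocBdd f := by
  intro R
  obtain ⟨C, hC⟩ := hinit R
  obtain ⟨D, hD⟩ := hd R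
  refine ⟨C + D * R, ?_⟩
  filter_upwards [hC, hD, h.slab_subset R] with j h1 h2 h3 z hz
  have h0 : (0 : ℝ) ∈ Icc (-R) 0 := ⟨hz.2.1.trans hz.2.2, le_rfl⟩
  have h4 := (convex_Icc (-R) 0).norm_image_sub_le_of_norm_hasDerivWithin_le
    (f := fun s => f j (z.1, s)) (f' := fun s => ∂ₜ (f j) (z.1, s)) (C := D)
    (fun s hs => (hasDerivAt_snd_slice (differentiableAt_of_contDiffOn (isOpen_strip _ _) (hf j)
      (h3 (show (z.1, s) ∈ slab R from ⟨hz.1, hs⟩)))).hasDerivWithinAt)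
    (fun s hs => h2 (z.1, s) ⟨hz.1, hs⟩) h0 hz.2
  have h5 := h1 z.1 hz.1
  have hD0 : 0 ≤ D := (norm_nonneg _).trans (h2 z hz)
  have h6 : ‖z.2 - 0‖ ≤ R := by
    rw [sub_zero, Real.norm_eq_abs, abs_le]
    exact ⟨hz.2.1, by linarith [hz.2.1, hz.2.2]⟩
  have h7 : ‖f j z‖ ≤ ‖f j (z.1, 0)‖ + ‖f j z - f j (z.1, 0)‖ := by
    simpa using norm_add_le (f j (z.1, 0)) (f j z - f j (z.1, 0))
  have h8 : D * ‖z.2 - 0‖ ≤ D * R := by gcongr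
  have h9 : ‖f j z - f j (z.1, 0)‖ ≤ D * ‖z.2 - 0‖ := h4
  linarith

/-- If a class of sequences of smooth functions is closed under both partial derivatives and
consists of locally bounded sequences, then all iterated derivatives are locally bounded. -/
theorem locBdd_iteratedFDeriv [NormedSpace ℝ F] (h : ExhaustPast a b) (P : (ℕ → ℝ × ℝ → F) → Prop)
    (hsmooth : ∀ f, P f → ∀ j, ContDiffOn ℝ ∞ (f j) (strip (a j) (b j)))
    (hbdd : ∀ f, P f → LocBdd f)
    (hX : ∀ f, P f → ∃ g, P g ∧ ∀ j, EqOn (∂ₓ (f j)) (g j) (strip (a j) (b j)))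
    (hT : ∀ f, P f → ∃ g, P g ∧ ∀ j, EqOn (∂ₜ (f j)) (g j) (strip (a j) (b j)))
    (k : ℕ) : ∀ f, P f → LocBdd fun j => iteratedFDeriv ℝ k (f j) := by
  induction k with
  | zero =>
    intro f hf
    exact (hbdd f hf).of_le 1 zero_le_one fun j z => by simp
  | succ k ih =>
    intro f hf
    obtain ⟨g₁, hg₁, e₁⟩ := hX f hf
    obtain ⟨g₂, hg₂, e₂⟩ := hT f hf
    set L₁ : F →L[ℝ] (ℝ × ℝ →L[ℝ] F) :=
      ContinuousLinearMap.smulRightL ℝ (ℝ × ℝ) F (ContinuousLinearMap.fst ℝ ℝ ℝ)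
    set L₂ : F →L[ℝ] (ℝ × ℝ →L[ℝ] F) :=
      ContinuousLinearMap.smulRightL ℝ (ℝ × ℝ) F (ContinuousLinearMap.snd ℝ ℝ ℝ)
    intro R
    obtain ⟨C₁, hC₁⟩ := ih g₁ hg₁ R
    obtain ⟨C₂, hC₂⟩ := ih g₂ hg₂ R
    refine ⟨‖L₁‖ * C₁ + ‖L₂‖ * C₂, ?_⟩
    filter_upwards [hC₁, hC₂, h.slab_subset R] with j h1 h2 h3 z hz
    have hU := (isOpen_strip (a j) (b j)).mem_nhds (h3 hz)
    have hfd : fderiv ℝ (f j) =ᶠ[𝓝 z] (L₁ ∘ g₁ j) + (L₂ ∘ g₂ j) := by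
      filter_upwards [hU] with y hy
      ext
      · simpa [L₁, L₂, ContinuousLinearMap.smulRightL, dirDeriv] using e₁ j hy
      · simpa [L₁, L₂, ContinuousLinearMap.smulRightL, dirDeriv] using e₂ j hy
    have c₁ : ContDiffAt ℝ ∞ (g₁ j) z := (hsmooth g₁ hg₁ j).contDiffAt hU
    have c₂ : ContDiffAt ℝ ∞ (g₂ j) z := (hsmooth g₂ hg₂ j).contDiffAt hU
    have hk : (k : WithTop ℕ∞) ≤ ∞ := by exact_mod_cast le_top
    rw [← norm_iteratedFDeriv_fderiv, (hfd.iteratedFDeriv ℝ k).eq_of_nhds,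
      iteratedFDeriv_add_apply ((L₁.contDiff.contDiffAt.comp z c₁).of_le hk)
        ((L₂.contDiff.contDiffAt.comp z c₂).of_le hk)]
    refine (norm_add_le _ _).trans (add_le_add ?_ ?_)
    · refine (L₁.norm_iteratedFDeriv_comp_left c₁ hk).trans ?_
      gcongr
      exact h1 z hz
    · refine (L₂.norm_iteratedFDeriv_comp_left c₂ hk).trans ?_
      gcongr
      exact h2 z hz

/-- Membership in the algebra generated by `S` propagates a rule of differentiation: if the
derivatives of the generators lie in a larger algebra `B`, so do those of all elements. -/
lemma exists_dirDeriv_eq_of_mem_adjoin {S : Set (ℕ → ℝ × ℝ → ℝ)}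
    {B : Subalgebra ℝ (ℕ → ℝ × ℝ → ℝ)} (hSB : Algebra.adjoin ℝ S ≤ B) (w : ℝ × ℝ)
    (hsmooth : ∀ f ∈ S, ∀ j, ContDiffOn ℝ ∞ (f j) (strip (a j) (b j)))
    (hd : ∀ f ∈ S, ∃ g ∈ B, ∀ j, EqOn (dirDeriv w (f j)) (g j) (strip (a j) (b j)))
    {f : ℕ → ℝ × ℝ → ℝ} (hf : f ∈ Algebra.adjoin ℝ S) :
    (∀ j, ContDiffOn ℝ ∞ (f j) (strip (a j) (b j))) ∧
      ∃ g ∈ B, ∀ j, EqOn (dirDeriv w (f j)) (g j) (strip (a j) (b j)) := by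
  have hdiff : ∀ (f : ℕ → ℝ × ℝ → ℝ), (∀ j, ContDiffOn ℝ ∞ (f j) (strip (a j) (b j))) →
      ∀ j, ∀ z ∈ strip (a j) (b j), DifferentiableAt ℝ (f j) z := fun f hf j z hz =>
    differentiableAt_of_contDiffOn (isOpen_strip _ _) (hf j) hz
  induction hf using Algebra.adjoin_induction with
  | mem f hf => exact ⟨hsmooth f hf, hd f hf⟩
  | algebraMap r =>
    refine ⟨fun j => contDiffOn_const, 0, B.zero_mem, fun j z _ => ?_⟩
    have : (algebraMap ℝ (ℕ → ℝ × ℝ → ℝ) r) j = fun _ => r := rfl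
    simp [this, dirDeriv]
  | add f g hf hg ihf ihg =>
    obtain ⟨sf, f', hf', ef⟩ := ihf
    obtain ⟨sg, g', hg', eg⟩ := ihg
    refine ⟨fun j => (sf j).add (sg j), f' + g', B.add_mem hf' hg', fun j z hz => ?_⟩
    have := dirDeriv_add (w := w) (hdiff f sf j z hz) (hdiff g sg j z hz)
    rw [ef j hz, eg j hz] at this
    exact this
  | mul f g hf hg ihf ihg =>
    obtain ⟨sf, f', hf', ef⟩ := ihf
    obtain ⟨sg, g', hg', eg⟩ := ihg
    refine ⟨fun j => (sf j).mul (sg j), f * g' + f' * g,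
      B.add_mem (B.mul_mem (hSB hf) hg') (B.mul_mem hf' (hSB hg)), fun j z hz => ?_⟩
    have := dirDeriv_mul (w := w) (hdiff f sf j z hz) (hdiff g sg j z hz)
    rw [ef j hz, eg j hz] at this
    exact this

lemma locBdd_of_mem_adjoin {S : Set (ℕ → ℝ × ℝ → ℝ)} (hS : ∀ f ∈ S, LocBdd f)
    {f : ℕ → ℝ × ℝ → ℝ} (hf : f ∈ Algebra.adjoin ℝ S) : LocBdd f := by
  induction hf using Algebra.adjoin_induction with
  | mem f hf => exact hS f hf
  | algebraMap r => exact fun R => ⟨‖r‖, Eventually.of_forall fun j z _ => le_rfl⟩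
  | add f g _ _ ihf ihg => exact ihf.add ihg
  | mul f g _ _ ihf ihg => exact ihf.mul ihg

end LocallyBounded

/-! ### Uniform bounds for sequences of normalised flows -/

section NormalisedFlows

variable {n : ℕ}

/-- A sequence of curve shortening flows whose time intervals exhaust the past, which are
parametrised by arclength at time `0`, pass through the origin, and whose curvatures are locally
bounded in time together with their arclength derivatives. -/
structure NormalisedFlows (G : ℕ → ℝ × ℝ → EuclideanSpace ℝ (Fin n)) (a b : ℕ → ℝ) : Prop
    extends ExhaustPast a b where
  flow : ∀ j, StripFlow (G j) (a j) (b j)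
  unit : ∀ j x, flowSpeed (G j) (x, 0) = 1
  base : ∀ j, G j (0, 0) = 0
  bound : ∀ m, LocBdd fun j => tangentDeriv (G j) m

/-- The derivative `∂ₓᵏ log v` of the logarithm of the speed. -/
def logSpeedDeriv (G : ℕ → ℝ × ℝ → EuclideanSpace ℝ (Fin n)) : ℕ → ℕ → ℝ × ℝ → ℝ
  | 0 => fun j z => Real.log (flowSpeed (G j) z)
  | k + 1 => fun j => ∂ₓ (logSpeedDeriv G k j)

/-- The functions that generate the algebra of all quantities needed to express the partial
derivatives of a flow; the derivatives of `log v` are taken up to the order `N`. -/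
inductive IsGenerator (G : ℕ → ℝ × ℝ → EuclideanSpace ℝ (Fin n)) (N : ℕ∞) :
    (ℕ → ℝ × ℝ → ℝ) → Prop
  | speed : IsGenerator G N fun j => flowSpeed (G j)
  | logSpeed (k : ℕ) (hk : k ≤ N) : IsGenerator G N (logSpeedDeriv G k)
  | tangent (m : ℕ) (i : Fin n) : IsGenerator G N fun j z => tangentDeriv (G j) m z i
  | position (i : Fin n) : IsGenerator G N fun j z => G j z i

/-- The algebra generated by the speed, the derivatives of its logarithm up to the order `N`, the
position, and all arclength derivatives of the unit tangent. -/
def flowAlgebra (G : ℕ → ℝ × ℝ → EuclideanSpace ℝ (Fin n)) (N : ℕ∞) :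
    Subalgebra ℝ (ℕ → ℝ × ℝ → ℝ) := Algebra.adjoin ℝ {f | IsGenerator G N f}

variable {G : ℕ → ℝ × ℝ → EuclideanSpace ℝ (Fin n)} {a b : ℕ → ℝ} {N : ℕ∞}

lemma flowAlgebra_mono {N N' : ℕ∞} (h : N ≤ N') : flowAlgebra G N ≤ flowAlgebra G N' := by
  refine Algebra.adjoin_mono fun f hf => ?_
  cases hf with
  | speed => exact .speed
  | logSpeed k hk => exact .logSpeed k (hk.trans h)
  | tangent m i => exact .tangent m i
  | position i => exact .position i

lemma mem_flowAlgebra {f : ℕ → ℝ × ℝ → ℝ} (h : IsGenerator G N f) : f ∈ flowAlgebra G N :=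
  Algebra.subset_adjoin h

lemma inner_mem_flowAlgebra (k l : ℕ) :
    (fun j z => ⟪tangentDeriv (G j) k z, tangentDeriv (G j) l z⟫) ∈ flowAlgebra G N := by
  have : (fun j z => ⟪tangentDeriv (G j) k z, tangentDeriv (G j) l z⟫) =
      ∑ i, (fun j z => tangentDeriv (G j) k z i) * fun j z => tangentDeriv (G j) l z i := by
    funext j z
    simp [PiLp.inner_apply, mul_comm]
  rw [this]
  exact sum_mem fun i _ => mul_mem (mem_flowAlgebra (.tangent k i)) (mem_flowAlgebra (.tangent l i))

lemma sqCurvature_mem_flowAlgebra :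
    (fun j z => ‖tangentDeriv (G j) 1 z‖ ^ 2) ∈ flowAlgebra G N := by
  simp only [← real_inner_self_eq_norm_sq]
  exact inner_mem_flowAlgebra 1 1

lemma reaction_mem_flowAlgebra (l : List (ℕ × ℕ × ℕ)) (i : Fin n) :
    (fun j z => StripFlow.reaction (G j) l z i) ∈ flowAlgebra G N := by
  induction l with
  | nil => exact (flowAlgebra G N).zero_mem
  | cons q l ih =>
    have : (fun j z => StripFlow.reaction (G j) (q :: l) z i) =
        (fun j z => ⟪tangentDeriv (G j) q.1 z, tangentDeriv (G j) q.2.1 z⟫) *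
          (fun j z => tangentDeriv (G j) q.2.2 z i) + fun j z => StripFlow.reaction (G j) l z i := by
      funext j z
      simp [StripFlow.reaction]
    rw [this]
    exact add_mem (mul_mem (inner_mem_flowAlgebra _ _) (mem_flowAlgebra (.tangent _ i))) ih

lemma dirDeriv_coord {f : ℝ × ℝ → EuclideanSpace ℝ (Fin n)} {z : ℝ × ℝ} (w : ℝ × ℝ)
    (hf : DifferentiableAt ℝ f z) (i : Fin n) :
    dirDeriv w (fun y => f y i) z = dirDeriv w f z i := by
  have := ((EuclideanSpace.proj (𝕜 := ℝ) i).hasFDerivAt (x := f z)).comp z hf.hasFDerivAt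
  have h2 : HasFDerivAt (fun y => f y i) ((EuclideanSpace.proj (𝕜 := ℝ) i).comp (fderiv ℝ f z)) z :=
    this
  simp [dirDeriv, h2.fderiv]

namespace NormalisedFlows

lemma contDiffOn_logSpeedDeriv (h : NormalisedFlows G a b) (k j : ℕ) :
    ContDiffOn ℝ ∞ (logSpeedDeriv G k j) (strip (a j) (b j)) := by
  induction k with
  | zero => exact (h.flow j).contDiffOn_flowSpeed.log fun z hz => ((h.flow j).flowSpeed_pos hz).ne'
  | succ k ih => exact contDiffOn_dirDeriv (isOpen_strip _ _) ih

lemma contDiffOn_of_isGenerator (h : NormalisedFlows G a b) {f : ℕ → ℝ × ℝ → ℝ}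
    (hf : IsGenerator G N f) (j : ℕ) : ContDiffOn ℝ ∞ (f j) (strip (a j) (b j)) := by
  cases hf with
  | speed => exact (h.flow j).contDiffOn_flowSpeed
  | logSpeed k hk => exact h.contDiffOn_logSpeedDeriv k j
  | tangent m i => exact contDiffOn_euclidean.1 ((h.flow j).contDiffOn_tangentDeriv m) i
  | position i => exact contDiffOn_euclidean.1 (h.flow j).smooth i

lemma dirDeriv_logSpeed (h : NormalisedFlows G a b) (w : ℝ × ℝ) {j : ℕ} {z : ℝ × ℝ}
    (hz : z ∈ strip (a j) (b j)) :
    dirDeriv w (logSpeedDeriv G 0 j) z = (flowSpeed (G j) z)⁻¹ * dirDeriv w (flowSpeed (G j)) z := by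
  have h1 := (h.flow j).flowSpeed_pos hz
  have h2 := differentiableAt_of_contDiffOn (isOpen_strip _ _) (h.flow j).contDiffOn_flowSpeed hz
  have h3 : HasFDerivAt (logSpeedDeriv G 0 j)
      ((flowSpeed (G j) z)⁻¹ • fderiv ℝ (flowSpeed (G j)) z) z := h2.hasFDerivAt.log h1.ne'
  simp [dirDeriv, h3.fderiv]

/-- The `x`-derivatives of the generators lie in the algebra with one more derivative of `log v`;
for the speed itself this is `∂ₓ v = v ∂ₓ log v`. -/
lemma exists_dX_generator (h : NormalisedFlows G a b) {f : ℕ → ℝ × ℝ → ℝ}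
    (hf : IsGenerator G N f) : ∃ g ∈ flowAlgebra G (N + 1),
      ∀ j, EqOn (∂ₓ (f j)) (g j) (strip (a j) (b j)) := by
  have hv : (fun j => flowSpeed (G j)) ∈ flowAlgebra G (N + 1) := mem_flowAlgebra .speed
  cases hf with
  | speed =>
    refine ⟨_, mul_mem hv (mem_flowAlgebra (.logSpeed 1 (by simp))), fun j z hz => ?_⟩
    have h1 := (h.flow j).flowSpeed_pos hz
    have h2 : logSpeedDeriv G 1 j z = (flowSpeed (G j) z)⁻¹ * ∂ₓ (flowSpeed (G j)) z :=
      h.dirDeriv_logSpeed _ hz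
    simp only [Pi.mul_apply, h2]
    rw [mul_inv_cancel_left₀ h1.ne']
  | logSpeed k hk =>
    refine ⟨_, mem_flowAlgebra (.logSpeed (k + 1) ?_), fun j z hz => rfl⟩
    push_cast
    gcongr
  | tangent m i =>
    refine ⟨_, mul_mem hv (mem_flowAlgebra (.tangent (m + 1) i)), fun j z hz => ?_⟩
    rw [dirDeriv_coord _ ((h.flow j).differentiableAt_tangentDeriv m hz),
      (h.flow j).dX_tangentDeriv m hz]
    simp
  | position i =>
    refine ⟨_, mul_mem hv (mem_flowAlgebra (.tangent 0 i)), fun j z hz => ?_⟩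
    rw [dirDeriv_coord _ (differentiableAt_of_contDiffOn (isOpen_strip _ _) (h.flow j).smooth hz),
      (h.flow j).dX_eq hz]
    simp [tangentDeriv]

lemma exists_dX (h : NormalisedFlows G a b) {f : ℕ → ℝ × ℝ → ℝ} (hf : f ∈ flowAlgebra G N) :
    (∀ j, ContDiffOn ℝ ∞ (f j) (strip (a j) (b j))) ∧ ∃ g ∈ flowAlgebra G (N + 1),
      ∀ j, EqOn (∂ₓ (f j)) (g j) (strip (a j) (b j)) :=
  exists_dirDeriv_eq_of_mem_adjoin (S := {f | IsGenerator G N f})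
    (flowAlgebra_mono le_self_add) _ (fun _ hf j => h.contDiffOn_of_isGenerator hf j)
    (fun _ hf => h.exists_dX_generator hf) hf

/-- The time derivative of `∂ₓᵏ⁺¹ log v` is `-∂ₓᵏ⁺¹ κ²`, which involves the derivatives of `log v`
only up to the order `k`. -/
lemma exists_dT_logSpeedDeriv_succ (h : NormalisedFlows G a b) (k : ℕ) :
    ∃ g ∈ flowAlgebra G k,
      ∀ j, EqOn (∂ₜ (logSpeedDeriv G (k + 1) j)) (g j) (strip (a j) (b j)) := by
  induction k with
  | zero =>
    refine ⟨(-2 : ℝ) • ((fun j => flowSpeed (G j)) *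
      fun j z => ⟪tangentDeriv (G j) 1 z, tangentDeriv (G j) 2 z⟫),
      Subalgebra.smul_mem _ (mul_mem (mem_flowAlgebra .speed) (inner_mem_flowAlgebra 1 2)) _,
      fun j z hz => ?_⟩
    have hU := isOpen_strip (a j) (b j)
    have hd := (h.flow j).differentiableAt_tangentDeriv 1 hz
    have h1 : EqOn (∂ₜ (logSpeedDeriv G 0 j)) (fun z => (-1 : ℝ) •
        ⟪tangentDeriv (G j) 1 z, tangentDeriv (G j) 1 z⟫) (strip (a j) (b j)) := fun y hy => by
      have h2 := (h.flow j).flowSpeed_pos hy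
      rw [h.dirDeriv_logSpeed _ hy, (h.flow j).dT_flowSpeed hy]
      simp only [real_inner_self_eq_norm_sq, smul_eq_mul]
      field_simp
    have h3 : ∂ₜ (logSpeedDeriv G 1 j) z = ∂ₓ (∂ₜ (logSpeedDeriv G 0 j)) z :=
      dirDeriv_comm hU (h.contDiffOn_logSpeedDeriv 0 j) hz
    have h4 : ∂ₓ (fun _ : ℝ × ℝ => (-1 : ℝ)) z = 0 := by simp [dirDeriv]
    rw [h3, dirDeriv_congr hU h1 hz, dirDeriv_smul (differentiableAt_const _) (hd.inner ℝ hd),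
      dirDeriv_inner hd hd, (h.flow j).dX_tangentDeriv 1 hz, h4]
    simp only [inner_smul_left, inner_smul_right, Pi.smul_apply, Pi.mul_apply, smul_eq_mul]
    rw [real_inner_comm (tangentDeriv (G j) 1 z) (tangentDeriv (G j) (1 + 1) z)]
    simp only [conj_trivial]
    ring
  | succ k ih =>
    obtain ⟨g, hg, e⟩ := ih
    obtain ⟨-, g', hg', e'⟩ := h.exists_dX hg
    refine ⟨g', by simpa using hg', fun j z hz => ?_⟩
    rw [← e' j hz, ← dirDeriv_congr (isOpen_strip _ _) (e j) hz]
    exact dirDeriv_comm (isOpen_strip _ _) (h.contDiffOn_logSpeedDeriv (k + 1) j) hz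

lemma dT_logSpeed (h : NormalisedFlows G a b) {j : ℕ} :
    EqOn (∂ₜ (logSpeedDeriv G 0 j)) (fun z => -‖tangentDeriv (G j) 1 z‖ ^ 2)
      (strip (a j) (b j)) := fun z hz => by
  have h2 := (h.flow j).flowSpeed_pos hz
  rw [h.dirDeriv_logSpeed _ hz, (h.flow j).dT_flowSpeed hz]
  field_simp

lemma exists_dT_generator (h : NormalisedFlows G a b) {f : ℕ → ℝ × ℝ → ℝ}
    (hf : IsGenerator G ⊤ f) : ∃ g ∈ flowAlgebra G ⊤,
      ∀ j, EqOn (∂ₜ (f j)) (g j) (strip (a j) (b j)) := by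
  have hv : (fun j => flowSpeed (G j)) ∈ flowAlgebra G ⊤ := mem_flowAlgebra .speed
  cases hf with
  | speed =>
    refine ⟨_, neg_mem (mul_mem sqCurvature_mem_flowAlgebra hv), fun j z hz => ?_⟩
    simpa using (h.flow j).dT_flowSpeed hz
  | logSpeed k hk =>
    cases k with
    | zero => exact ⟨_, neg_mem sqCurvature_mem_flowAlgebra, fun j => h.dT_logSpeed⟩
    | succ k =>
      obtain ⟨g, hg, e⟩ := h.exists_dT_logSpeedDeriv_succ k
      exact ⟨g, flowAlgebra_mono le_top hg, e⟩
  | tangent m i =>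
    refine ⟨_, add_mem (mem_flowAlgebra (.tangent (m + 2) i))
      (reaction_mem_flowAlgebra (StripFlow.reactionList m) i), fun j z hz => ?_⟩
    rw [dirDeriv_coord _ ((h.flow j).differentiableAt_tangentDeriv m hz),
      (h.flow j).dT_tangentDeriv m hz]
    simp
  | position i =>
    refine ⟨_, mem_flowAlgebra (.tangent 1 i), fun j z hz => ?_⟩
    rw [dirDeriv_coord _ (differentiableAt_of_contDiffOn (isOpen_strip _ _) (h.flow j).smooth hz),
      (h.flow j).flow z hz]

lemma locBdd_coord {f : ℕ → ℝ × ℝ → EuclideanSpace ℝ (Fin n)} (hf : LocBdd f) (i : Fin n) :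
    LocBdd fun j z => f j z i :=
  hf.of_le 1 zero_le_one fun j z => by simpa using PiLp.norm_apply_le (f j z) i

lemma locBdd_position (h : NormalisedFlows G a b) : LocBdd G := by
  refine LocBdd.of_dT h.toExhaustPast (fun j => (h.flow j).smooth) (fun R => ⟨R, ?_⟩)
    ((h.bound 1).congr h.toExhaustPast fun j => (h.flow j).flow)
  refine Eventually.of_forall fun j x hx => ?_
  have hz : ∀ y : ℝ, (y, (0 : ℝ)) ∈ strip (a j) (b j) := fun y =>
    mem_strip.2 ⟨h.neg j, h.pos j⟩
  have h1 := (convex_univ (𝕜 := ℝ) (E := ℝ)).norm_image_sub_le_of_norm_hasDerivWithin_le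
    (f := fun y => G j (y, 0)) (f' := fun y => ∂ₓ (G j) (y, 0)) (C := 1)
    (fun y _ => (hasDerivAt_fst_slice (differentiableAt_of_contDiffOn (isOpen_strip _ _)
      (h.flow j).smooth (hz y))).hasDerivWithinAt)
    (fun y _ => (h.unit j y).le) (mem_univ 0) (mem_univ x)
  simp only [h.base j, sub_zero, one_mul] at h1
  exact h1.trans (abs_le.2 hx)

lemma logSpeedDeriv_zero (h : NormalisedFlows G a b) (k j : ℕ) (x : ℝ) :
    logSpeedDeriv G k j (x, 0) = 0 := by
  induction k generalizing x with
  | zero => simp [logSpeedDeriv, h.unit]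
  | succ k ih =>
    have hz : (x, (0 : ℝ)) ∈ strip (a j) (b j) := mem_strip.2 ⟨h.neg j, h.pos j⟩
    have h1 := hasDerivAt_fst_slice (differentiableAt_of_contDiffOn (isOpen_strip _ _)
      (h.contDiffOn_logSpeedDeriv k j) hz)
    simp only [ih] at h1
    exact h1.unique (hasDerivAt_const x 0)

lemma locBdd_logSpeed (h : NormalisedFlows G a b) : LocBdd (logSpeedDeriv G 0) := by
  have h1 : LocBdd fun j z => -‖tangentDeriv (G j) 1 z‖ ^ 2 := by
    have := (h.bound 1).of_le (f := fun j z => ‖tangentDeriv (G j) 1 z‖) 1 zero_le_one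
      fun j z => by simp
    exact (this.mul this).of_le 1 zero_le_one fun j z => by simp [sq]
  exact LocBdd.of_dT h.toExhaustPast (h.contDiffOn_logSpeedDeriv 0)
    (fun R => ⟨0, Eventually.of_forall fun j x _ => by simp [h.logSpeedDeriv_zero]⟩)
    (h1.congr h.toExhaustPast fun j => h.dT_logSpeed)

lemma locBdd_flowSpeed (h : NormalisedFlows G a b) : LocBdd fun j => flowSpeed (G j) := by
  intro R
  obtain ⟨C, hC⟩ := h.locBdd_logSpeed R
  refine ⟨Real.exp C, ?_⟩
  filter_upwards [hC, h.slab_subset R] with j h1 h2 z hz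
  have h3 := (h.flow j).flowSpeed_pos (h2 hz)
  rw [Real.norm_eq_abs, abs_of_pos h3, ← Real.log_le_iff_le_exp h3]
  exact (le_abs_self _).trans (h1 z hz)

lemma locBdd_of_isGenerator (h : NormalisedFlows G a b)
    (hlog : ∀ k : ℕ, k ≤ N → LocBdd (logSpeedDeriv G k)) {f : ℕ → ℝ × ℝ → ℝ}
    (hf : IsGenerator G N f) : LocBdd f := by
  cases hf with
  | speed => exact h.locBdd_flowSpeed
  | logSpeed k hk => exact hlog k hk
  | tangent m i => exact locBdd_coord (h.bound m) i
  | position i => exact locBdd_coord h.locBdd_position i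

lemma locBdd_logSpeedDeriv (h : NormalisedFlows G a b) (k : ℕ) : LocBdd (logSpeedDeriv G k) := by
  induction k using Nat.strong_induction_on with
  | _ k ih =>
    cases k with
    | zero => exact h.locBdd_logSpeed
    | succ k =>
      obtain ⟨g, hg, e⟩ := h.exists_dT_logSpeedDeriv_succ k
      have hgb : LocBdd g := locBdd_of_mem_adjoin (fun f hf => h.locBdd_of_isGenerator
        (fun i hi => ih i (by have : i ≤ k := by exact_mod_cast hi
                              omega)) hf) hg
      exact LocBdd.of_dT h.toExhaustPast (h.contDiffOn_logSpeedDeriv (k + 1))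
        (fun R => ⟨0, Eventually.of_forall fun j x _ => by simp [h.logSpeedDeriv_zero]⟩)
        (hgb.congr h.toExhaustPast e)

/-- All derivatives of a sequence of normalised flows are locally bounded. -/
theorem locBdd_iteratedFDeriv_position (h : NormalisedFlows G a b) (k : ℕ) :
    LocBdd fun j => iteratedFDeriv ℝ k (G j) := by
  have hU := fun j => isOpen_strip (a j) (b j)
  have hmem : ∀ f ∈ flowAlgebra G ⊤, _ := fun f hf => h.exists_dX (N := ⊤) hf
  have hsm : ∀ f : ℕ → ℝ × ℝ → EuclideanSpace ℝ (Fin n),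
      (∀ i, (fun j z => f j z i) ∈ flowAlgebra G ⊤) →
      ∀ j, ContDiffOn ℝ ∞ (f j) (strip (a j) (b j)) := fun f hf j =>
    contDiffOn_euclidean.2 fun i => (hmem _ (hf i)).1 j
  have hder : ∀ w : ℝ × ℝ, (∀ f ∈ flowAlgebra G ⊤, ∃ g ∈ flowAlgebra G ⊤,
      ∀ j, EqOn (dirDeriv w (f j)) (g j) (strip (a j) (b j))) →
      ∀ f : ℕ → ℝ × ℝ → EuclideanSpace ℝ (Fin n), (∀ i, (fun j z => f j z i) ∈ flowAlgebra G ⊤) →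
      ∃ g : ℕ → ℝ × ℝ → EuclideanSpace ℝ (Fin n), (∀ i, (fun j z => g j z i) ∈ flowAlgebra G ⊤) ∧
        ∀ j, EqOn (dirDeriv w (f j)) (g j) (strip (a j) (b j)) := by
    intro w hw f hf
    choose g hg e using fun i => hw _ (hf i)
    refine ⟨fun j z => WithLp.toLp 2 fun i => g i j z, fun i => by simpa using hg i,
      fun j z hz => ?_⟩
    ext i
    rw [← dirDeriv_coord w (differentiableAt_of_contDiffOn (hU j) (hsm f hf j) hz), e i j hz]
  refine locBdd_iteratedFDeriv h.toExhaustPast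
    (fun f : ℕ → ℝ × ℝ → EuclideanSpace ℝ (Fin n) => ∀ i, (fun j z => f j z i) ∈ flowAlgebra G ⊤) hsm ?_ ?_ ?_ k G
    fun i => mem_flowAlgebra (.position i)
  · intro f hf
    have hb : ∀ i : Fin n, LocBdd fun (j : ℕ) (z : ℝ × ℝ) => f j z i := fun i => locBdd_of_mem_adjoin (fun g hg =>
      h.locBdd_of_isGenerator (N := ⊤) (fun k _ => h.locBdd_logSpeedDeriv k) hg) (hf i)
    intro R
    choose C hC using fun i => hb i R
    refine ⟨∑ i, C i, ?_⟩
    filter_upwards [eventually_all.2 hC] with j hj z hz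
    calc ‖f j z‖ = ‖∑ i, EuclideanSpace.single i (f j z i)‖ := by
          congr 1
          ext i
          simp [Finset.sum_apply]
      _ ≤ ∑ i, ‖EuclideanSpace.single i (f j z i)‖ := norm_sum_le _ _
      _ ≤ ∑ i, C i := Finset.sum_le_sum fun i _ => by simpa using hj i z hz
  · exact hder _ fun f hf => by simpa using (hmem f hf).2
  · exact hder _ fun f hf => (exists_dirDeriv_eq_of_mem_adjoin (S := {f | IsGenerator G ⊤ f})
      le_rfl _ (fun _ hf j => h.contDiffOn_of_isGenerator hf j)
      (fun _ hf => h.exists_dT_generator hf) hf).2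

end NormalisedFlows

end NormalisedFlows

/-! ### Compactness in the topology of smooth local convergence -/

section Compactness

open Metric TopologicalSpace

/-- A second order Taylor estimate, unlike differentiability itself, passes to pointwise limits. -/
lemma hasFDerivWithinAt_of_norm_sub_le_sq {V W : Type*} [NormedAddCommGroup V] [NormedSpace ℝ V]
    [NormedAddCommGroup W] [NormedSpace ℝ W] {g : V → W} {g' : V →L[ℝ] W} {S : Set V} {x : V}
    {C : ℝ} (h : ∀ᶠ y in 𝓝[S] x, ‖g y - g x - g' (y - x)‖ ≤ C * ‖y - x‖ ^ 2) :
    HasFDerivWithinAt g g' S x := by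
  rw [hasFDerivWithinAt_iff_isLittleO]
  have h1 : (fun y => g y - g x - g' (y - x)) =O[𝓝[S] x] fun y => ‖y - x‖ ^ 2 :=
    Asymptotics.IsBigO.of_bound C (h.mono fun y hy => by simpa using hy)
  refine h1.trans_isLittleO ?_
  have h2 : Tendsto (fun y => y - x) (𝓝[S] x) (𝓝 0) := by
    have : Tendsto (fun y => y - x) (𝓝 x) (𝓝 (x - x)) := (continuous_sub_right x).tendsto x
    rw [sub_self] at this
    exact this.mono_left nhdsWithin_le_nhds
  have h3 := (Asymptotics.isLittleO_norm_pow_id (E' := V) one_lt_two).comp_tendsto h2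
  exact h3

/-- A sequence of functions that is eventually bounded at each point of a countable set converges
there along a subsequence; the functions may take values in a different space for each point. -/
lemma exists_subseq_tendsto_of_countable {ι : Type*} [Countable ι] {W : ι → Type*}
    [∀ i, NormedAddCommGroup (W i)] [∀ i, ProperSpace (W i)] (u : ℕ → ∀ i, W i)
    (hu : ∀ i, ∃ C : ℝ, ∀ᶠ j in atTop, ‖u j i‖ ≤ C) :
    ∃ φ : ℕ → ℕ, StrictMono φ ∧ ∀ i, ∃ l, Tendsto (fun j => u (φ j) i) atTop (𝓝 l) := by
  have hb : ∀ i, ∃ C : ℝ, ∀ j, ‖u j i‖ ≤ C := fun i => by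
    obtain ⟨C, hC⟩ := hu i
    have h1 : IsBoundedUnder (· ≤ ·) atTop fun j => ‖u j i‖ := ⟨C, by simpa using hC⟩
    obtain ⟨D, hD⟩ := h1.bddAbove_range
    exact ⟨D, fun j => hD ⟨j, rfl⟩⟩
  choose C hC using hb
  have hK : IsCompact (univ.pi fun i => closedBall (0 : W i) (C i)) :=
    isCompact_univ_pi fun i => isCompact_closedBall _ _
  obtain ⟨l, -, φ, hφ, hl⟩ := hK.tendsto_subseq (x := u) fun j i _ => by simpa using hC i j
  exact ⟨φ, hφ, fun i => ⟨l i, (tendsto_pi_nhds.1 hl) i⟩⟩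

/-- Local equi-Lipschitz bounds turn pointwise convergence on a dense subset into locally uniform
convergence. -/
lemma exists_tendstoUniformlyOn_of_dense {V W : Type*} [NormedAddCommGroup V]
    [NormedAddCommGroup W] [CompleteSpace W] {S : Set V} (u : ℕ → V → W) {d : ℕ → S}
    (hd : DenseRange d) (hconv : ∀ i, ∃ l, Tendsto (fun j => u j (d i)) atTop (𝓝 l))
    (hlip : ∀ R : ℝ, ∃ C : ℝ, ∀ᶠ j in atTop, ∀ x ∈ S ∩ closedBall 0 R, ∀ y ∈ S ∩ closedBall 0 R,
      ‖u j y - u j x‖ ≤ C * ‖y - x‖) :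
    ∃ g : V → W, ∀ K ⊆ S, IsCompact K → TendstoUniformlyOn u g atTop K := by
  have hcauchy : ∀ K ⊆ S, IsCompact K → UniformCauchySeqOn u atTop K := by
    intro K hKS hK
    obtain ⟨R, hR⟩ := hK.isBounded.subset_closedBall 0
    obtain ⟨C, hC⟩ := hlip (R + 1)
    rw [Metric.uniformCauchySeqOn_iff]
    intro ε hε
    set δ := min 1 (ε / (4 * (|C| + 1))) with hδ
    have hC0 := abs_nonneg C
    have hδ0 : 0 < δ := by positivity
    have hCδ : C * δ ≤ ε / 4 := by
      have h1 : C * δ ≤ |C| * (ε / (4 * (|C| + 1))) := by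
        gcongr
        · exact le_abs_self C
        · exact min_le_right _ _
      have h2 : |C| * (ε / (4 * (|C| + 1))) ≤ (|C| + 1) * (ε / (4 * (|C| + 1))) := by
        gcongr; linarith
      have h3 : (|C| + 1) * (ε / (4 * (|C| + 1))) = ε / 4 := by field_simp
      linarith
    obtain ⟨t, ht⟩ := hK.elim_finite_subcover (fun i => ball (d i : V) δ) (fun i => isOpen_ball)
      (fun z hz => by
        obtain ⟨i, hi⟩ := hd.exists_dist_lt ⟨z, hKS hz⟩ hδ0
        exact mem_iUnion.2 ⟨i, hi⟩)
    have hev : ∀ i ∈ t, ∃ N, ∀ m ≥ N, ∀ k ≥ N, dist (u m (d i)) (u k (d i)) < ε / 4 := by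
      intro i _
      obtain ⟨l, hl⟩ := hconv i
      exact Metric.cauchySeq_iff.1 hl.cauchySeq (ε / 4) (by linarith)
    choose! N hN using hev
    obtain ⟨N₀, hN₀⟩ := eventually_atTop.1 hC
    refine ⟨max N₀ (t.sup N), fun m hm k hk z hz => ?_⟩
    obtain ⟨i, hit, hi⟩ : ∃ i ∈ t, z ∈ ball (d i : V) δ := by simpa using ht hz
    have hzR : z ∈ S ∩ closedBall 0 (R + 1) :=
      ⟨hKS hz, closedBall_subset_closedBall (by linarith) (hR hz)⟩
    have hzi : ‖(d i : V) - z‖ ≤ δ := by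
      rw [← dist_eq_norm, dist_comm]; exact (mem_ball.1 hi).le
    have hdR : (d i : V) ∈ S ∩ closedBall 0 (R + 1) := by
      refine ⟨(d i).2, ?_⟩
      rw [mem_closedBall_zero_iff]
      have h1 : ‖z‖ ≤ R := mem_closedBall_zero_iff.1 (hR hz)
      have h2 : ‖(d i : V)‖ ≤ ‖z‖ + ‖(d i : V) - z‖ := by
        simpa using norm_add_le z ((d i : V) - z)
      have h3 : δ ≤ 1 := min_le_left _ _
      linarith
    have hle : ∀ m ≥ N₀, dist (u m (d i)) (u m z) ≤ ε / 4 := by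
      intro m hm
      rw [dist_eq_norm]
      have h1 := hN₀ m hm z hzR (d i) hdR
      have h5 : 0 ≤ C ∨ C ≤ 0 := le_total 0 C
      rcases h5 with h5 | h5
      · exact h1.trans ((mul_le_mul_of_nonneg_left hzi h5).trans hCδ)
      · exact h1.trans ((mul_nonpos_of_nonpos_of_nonneg h5 (norm_nonneg _)).trans (by linarith))
    have hti : N i ≤ t.sup N := Finset.le_sup hit
    have hmid := hN i hit m (by omega) k (by omega)
    have e1 := hle m (by omega)
    have e2 := hle k (by omega)
    rw [dist_comm] at e1
    calc dist (u m z) (u k z) ≤ dist (u m z) (u m (d i)) + dist (u m (d i)) (u k (d i)) +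
          dist (u k (d i)) (u k z) := dist_triangle4 _ _ _ _
      _ < ε := by linarith
  have hpt : ∀ z ∈ S, ∃ l, Tendsto (fun j => u j z) atTop (𝓝 l) := fun z hz =>
    cauchySeq_tendsto_of_complete ((hcauchy {z} (by simpa using hz) isCompact_singleton).cauchySeq
      (mem_singleton z))
  choose! g hg using hpt
  exact ⟨g, fun K hKS hK =>
    (hcauchy K hKS hK).tendstoUniformlyOn_of_tendsto fun z hz => hg z (hKS hz)⟩

variable {V F : Type*} [NormedAddCommGroup V] [NormedSpace ℝ V] [NormedAddCommGroup F]
  [NormedSpace ℝ F]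

instance finiteDimensional_continuousMultilinearMap [FiniteDimensional ℝ V]
    [FiniteDimensional ℝ F] (k : ℕ) : FiniteDimensional ℝ (V [×k]→L[ℝ] F) :=
  FiniteDimensional.of_injective
    (ContinuousMultilinearMap.toMultilinearMapLinear :
      (V [×k]→L[ℝ] F) →ₗ[ℝ] MultilinearMap ℝ (fun _ : Fin k => V) F)
    ContinuousMultilinearMap.toMultilinearMap_injective

/-- A sequence of functions on a convex set `S` whose derivatives of every order are eventually
bounded on bounded subsets of `S` has a subsequence that converges smoothly on compact subsets. -/
theorem exists_subseq_smoothlyConvergesOn [FiniteDimensional ℝ V] [FiniteDimensional ℝ F]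
    {S : Set V} (hS : Convex ℝ S) (hne : S.Nonempty) (hSu : UniqueDiffOn ℝ S) (f : ℕ → V → F)
    (hsm : ∀ R : ℝ, ∀ᶠ j in atTop, ∀ z ∈ S ∩ closedBall 0 R, ContDiffWithinAt ℝ ∞ (f j) S z)
    (hb : ∀ (k : ℕ) (R : ℝ), ∃ C : ℝ, ∀ᶠ j in atTop, ∀ z ∈ S ∩ closedBall 0 R,
      ‖iteratedFDerivWithin ℝ k (f j) S z‖ ≤ C) :
    ∃ φ : ℕ → ℕ, StrictMono φ ∧ ∃ g : V → F, ContDiffOn ℝ ∞ g S ∧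
      SmoothlyConvergesOn (fun j => f (φ j)) g S := by
  have : ∀ k : ℕ, ProperSpace (V [×k]→L[ℝ] F) := fun k => FiniteDimensional.proper ℝ _
  have hSR : ∀ R : ℝ, Convex ℝ (S ∩ closedBall 0 R) := fun R => hS.inter (convex_closedBall 0 R)
  have hderiv : ∀ (k : ℕ) (R : ℝ), ∀ᶠ j in atTop, ∀ z ∈ S ∩ closedBall 0 R,
      HasFDerivWithinAt (iteratedFDerivWithin ℝ k (f j) S)
        (iteratedFDerivWithin ℝ (k + 1) (f j) S z).curryLeft S z := by
    intro k R
    filter_upwards [hsm R] with j hj z hz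
    have hd : DifferentiableWithinAt ℝ (iteratedFDerivWithin ℝ k (f j) S) S z :=
      (hj z hz).differentiableWithinAt_iteratedFDerivWithin (by exact_mod_cast ENat.natCast_lt_top k)
        (by rwa [insert_eq_of_mem hz.1])
    exact hd.hasFDerivWithinAt
  have hlip : ∀ (k : ℕ) (R : ℝ), ∃ C : ℝ, ∀ᶠ j in atTop, ∀ x ∈ S ∩ closedBall 0 R,
      ∀ y ∈ S ∩ closedBall 0 R, ‖iteratedFDerivWithin ℝ k (f j) S y -
        iteratedFDerivWithin ℝ k (f j) S x‖ ≤ C * ‖y - x‖ := by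
    intro k R
    obtain ⟨C, hC⟩ := hb (k + 1) R
    refine ⟨C, ?_⟩
    filter_upwards [hC, hderiv k R] with j h1 h2 x hx y hy
    exact (hSR R).norm_image_sub_le_of_norm_hasFDerivWithin_le
      (fun z hz => (h2 z hz).mono inter_subset_left)
      (fun z hz => by rw [ContinuousMultilinearMap.curryLeft_norm]; exact h1 z hz) hx hy
  have htaylor : ∀ (k : ℕ) (R : ℝ), ∃ C : ℝ, ∀ᶠ j in atTop, ∀ x ∈ S ∩ closedBall 0 R,
      ∀ y ∈ S ∩ closedBall 0 R, ‖iteratedFDerivWithin ℝ k (f j) S y -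
        iteratedFDerivWithin ℝ k (f j) S x -
        (iteratedFDerivWithin ℝ (k + 1) (f j) S x).curryLeft (y - x)‖ ≤ C * ‖y - x‖ ^ 2 := by
    intro k R
    obtain ⟨C, hC⟩ := hlip (k + 1) R
    refine ⟨|C|, ?_⟩
    filter_upwards [hC, hderiv k R] with j h1 h2 x hx y hy
    have h3 := ((hSR R).inter (convex_closedBall x ‖y - x‖)).norm_image_sub_le_of_norm_hasFDerivWithin_le'
      (φ := (iteratedFDerivWithin ℝ (k + 1) (f j) S x).curryLeft) (C := |C| * ‖y - x‖)
      (fun z hz => (h2 z hz.1).mono (inter_subset_left.trans inter_subset_left))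
      (fun z hz => by
        have h4 : (iteratedFDerivWithin ℝ (k + 1) (f j) S z).curryLeft -
            (iteratedFDerivWithin ℝ (k + 1) (f j) S x).curryLeft =
            (iteratedFDerivWithin ℝ (k + 1) (f j) S z -
              iteratedFDerivWithin ℝ (k + 1) (f j) S x).curryLeft := rfl
        rw [h4, ContinuousMultilinearMap.curryLeft_norm]
        have h5 : ‖z - x‖ ≤ ‖y - x‖ := by rw [← dist_eq_norm]; exact hz.2
        calc _ ≤ C * ‖z - x‖ := h1 x hx z hz.1
          _ ≤ |C| * ‖y - x‖ := by
            gcongr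
            exact le_abs_self C)
      ⟨hx, mem_closedBall_self (norm_nonneg _)⟩ ⟨hy, by simp [dist_eq_norm]⟩
    calc _ ≤ |C| * ‖y - x‖ * ‖y - x‖ := h3
      _ = |C| * ‖y - x‖ ^ 2 := by ring
  -- A diagonal subsequence along which all derivatives converge on a countable dense set.
  have : Nonempty S := hne.to_subtype
  have : SeparableSpace S := inferInstance
  set d := denseSeq S
  obtain ⟨φ, hφ, hconv⟩ := exists_subseq_tendsto_of_countable (ι := ℕ × ℕ)
    (W := fun p => V [×p.1]→L[ℝ] F)
    (fun j p => iteratedFDerivWithin ℝ p.1 (f j) S (d p.2)) fun p => by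
      obtain ⟨C, hC⟩ := hb p.1 ‖(d p.2 : V)‖
      exact ⟨C, hC.mono fun j hj => hj _ ⟨(d p.2).2, by simp⟩⟩
  have hφt := hφ.tendsto_atTop
  have hlim : ∀ k, ∃ g : V → V [×k]→L[ℝ] F, ∀ K ⊆ S, IsCompact K →
      TendstoUniformlyOn (fun j => iteratedFDerivWithin ℝ k (f (φ j)) S) g atTop K := fun k =>
    exists_tendstoUniformlyOn_of_dense _ (denseRange_denseSeq S) (fun i => hconv (k, i)) fun R => by
      obtain ⟨C, hC⟩ := hlip k R
      exact ⟨C, hφt.eventually hC⟩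
  choose g hg using hlim
  have hpt : ∀ k, ∀ z ∈ S, Tendsto (fun j => iteratedFDerivWithin ℝ k (f (φ j)) S z) atTop
      (𝓝 (g k z)) := fun k z hz =>
    (hg k {z} (by simpa using hz) isCompact_singleton).tendsto_at (mem_singleton z)
  have hgd : ∀ k, ∀ x ∈ S, HasFDerivWithinAt (g k) (g (k + 1) x).curryLeft S x := by
    intro k x hx
    obtain ⟨C, hC⟩ := htaylor k (‖x‖ + 1)
    refine hasFDerivWithinAt_of_norm_sub_le_sq (C := C) ?_
    have hx' : x ∈ S ∩ closedBall 0 (‖x‖ + 1) := ⟨hx, by simp⟩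
    filter_upwards [self_mem_nhdsWithin, mem_nhdsWithin_of_mem_nhds (ball_mem_nhds x one_pos)]
      with y hy hy1
    have hy' : y ∈ S ∩ closedBall 0 (‖x‖ + 1) := by
      refine ⟨hy, ?_⟩
      rw [mem_closedBall_zero_iff]
      have h1 : ‖y‖ ≤ ‖x‖ + ‖y - x‖ := by simpa using norm_add_le x (y - x)
      have h2 : ‖y - x‖ < 1 := by rw [← dist_eq_norm]; exact hy1
      linarith
    have hcl : Tendsto (fun j => (iteratedFDerivWithin ℝ (k + 1) (f (φ j)) S x).curryLeft (y - x))
        atTop (𝓝 ((g (k + 1) x).curryLeft (y - x))) := by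
      have h1 : Continuous fun m : V [×(k + 1)]→L[ℝ] F => m.curryLeft (y - x) :=
        ((ContinuousLinearMap.apply ℝ (V [×k]→L[ℝ] F) (y - x)).continuous).comp
          (continuousMultilinearCurryLeftEquiv ℝ (fun _ : Fin (k + 1) => V) F).continuous
      exact (h1.tendsto _).comp (hpt (k + 1) x hx)
    refine le_of_tendsto (((hpt k y hy).sub (hpt k x hx)).sub hcl).norm ?_
    filter_upwards [hφt.eventually hC] with j hj using hj x hx' y hy'
  have hser : HasFTaylorSeriesUpToOn ∞ (fun z => (g 0 z).curry0) (fun z k => g k z) S :=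
    { zero_eq := fun _ _ => rfl
      fderivWithin := fun m _ x hx => hgd m x hx
      cont := fun m _ x hx => (hgd m x hx).continuousWithinAt }
  refine ⟨φ, hφ, fun z => (g 0 z).curry0, hser.contDiffOn, fun k K hKS hK => ?_⟩
  refine (hg k K hKS hK).congr_right fun z hz => ?_
  exact hser.eq_iteratedFDerivWithin_of_uniqueDiffOn (by exact_mod_cast le_top) hSu (hKS hz)

end Compactness

/-! ### Time slices of a flow and changes of scale and parameter -/

section Bridge

variable {E : Type*} [NormedAddCommGroup E] [InnerProductSpace ℝ E]
variable {G : ℝ × ℝ → E} {a b : ℝ} {z : ℝ × ℝ}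

section Slice

variable (hs : ContDiffOn ℝ ∞ G (strip a b)) (hi : ∀ z ∈ strip a b, ∂ₓ G z ≠ 0)
include hs

lemma deriv_slice (hz : z ∈ strip a b) : deriv (fun q => G (q, z.2)) z.1 = ∂ₓ G z :=
  (hasDerivAt_fst_slice (differentiableAt_of_contDiffOn (isOpen_strip a b) hs hz)).deriv

lemma speed_slice (hz : z ∈ strip a b) : speed (fun q => G (q, z.2)) z.1 = flowSpeed G z := by
  rw [speed, deriv_slice hs hz, flowSpeed]

lemma unitTangent_slice (hz : z ∈ strip a b) :
    unitTangent (fun q => G (q, z.2)) z.1 = tangentDeriv G 0 z := by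
  rw [unitTangent, arcDeriv, deriv_slice hs hz, speed_slice hs hz, tangentDeriv, dS]

include hi

lemma curvatureVector_slice (hz : z ∈ strip a b) :
    curvatureVector (fun q => G (q, z.2)) z.1 = tangentDeriv G 1 z := by
  have h1 : unitTangent (fun q => G (q, z.2)) = fun q => tangentDeriv G 0 (q, z.2) := by
    funext q
    exact unitTangent_slice hs (z := (q, z.2)) (mem_strip.2 (mem_strip.1 hz))
  have hU := isOpen_strip a b
  have h2 : ContDiffOn ℝ ∞ (tangentDeriv G 0) (strip a b) :=
    contDiffOn_dS hU ((contDiffOn_dirDeriv hU hs).norm ℝ hi) (fun y hy => norm_ne_zero_iff.2 (hi y hy)) hs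
  rw [curvatureVector, arcDeriv, h1, deriv_slice h2 hz, speed_slice hs hz]
  rfl

end Slice

lemma IsFlow.stripFlow {γ : ℝ → ℝ → E} {Ω : ℝ} (h : IsFlow γ (Ico 0 Ω)) :
    StripFlow (fun z => γ z.1 z.2) 0 Ω := by
  have hsub : strip 0 Ω ⊆ univ ×ˢ Ico 0 Ω := prod_mono le_rfl Ioo_subset_Ico_self
  have hs : ContDiffOn ℝ ∞ (fun z : ℝ × ℝ => γ z.1 z.2) (strip 0 Ω) := h.smooth.mono hsub
  have hi : ∀ z ∈ strip 0 Ω, ∂ₓ (fun z : ℝ × ℝ => γ z.1 z.2) z ≠ 0 := fun z hz => by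
    rw [← deriv_slice hs hz]
    exact h.immersed z.2 (hsub hz).2 z.1
  refine ⟨hs, hi, fun z hz => ?_⟩
  have h1 := h.flow z.2 (hsub hz).2 z.1
  have h2 : Ico 0 Ω ∈ 𝓝 z.2 := Ico_mem_nhds (mem_strip.1 hz).1 (mem_strip.1 hz).2
  have h3 := hasDerivAt_snd_slice
    (x := z.1) (t := z.2) (differentiableAt_of_contDiffOn (isOpen_strip 0 Ω) hs hz)
  rw [← curvatureVector_slice hs hi hz]
  exact h3.unique (h1.hasDerivAt h2)

/-- The space-time change of variables of a parabolic rescaling with factor `l`, centred at the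
time `t₀`, combined with a reparametrisation `P` of the curves. -/
def rescaleMap (P : ℝ → ℝ) (l t₀ : ℝ) (z : ℝ × ℝ) : ℝ × ℝ := (P z.1, t₀ + z.2 / l ^ 2)

section Rescale

variable {P P' : ℝ → ℝ} {l t₀ : ℝ} {F : Type*} [NormedAddCommGroup F] [NormedSpace ℝ F]

lemma rescaleMap_mem_strip (hl : 0 < l) :
    rescaleMap P l t₀ z ∈ strip a b ↔ z ∈ strip (l ^ 2 * (a - t₀)) (l ^ 2 * (b - t₀)) := by
  have hl2 : 0 < l ^ 2 := by positivity
  simp only [mem_strip, rescaleMap]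
  rw [← sub_lt_iff_lt_add', ← lt_sub_iff_add_lt', lt_div_iff₀' hl2, div_lt_iff₀' hl2]

lemma dirDeriv_comp_rescaleMap {f : ℝ × ℝ → F} (hP : ∀ x, HasDerivAt P (P' x) x)
    (hf : DifferentiableAt ℝ f (rescaleMap P l t₀ z)) (w : ℝ × ℝ) :
    dirDeriv w (fun y => f (rescaleMap P l t₀ y)) z =
      dirDeriv (w.1 * P' z.1, w.2 / l ^ 2) f (rescaleMap P l t₀ z) := by
  have h1 : HasFDerivAt (fun y : ℝ × ℝ => P y.1)
      ((ContinuousLinearMap.toSpanSingleton ℝ (P' z.1)).comp (ContinuousLinearMap.fst ℝ ℝ ℝ)) z :=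
    (hP z.1).hasFDerivAt.comp z hasFDerivAt_fst
  have h2 : HasFDerivAt (fun y : ℝ × ℝ => t₀ + y.2 / l ^ 2)
      ((l ^ 2)⁻¹ • ContinuousLinearMap.snd ℝ ℝ ℝ) z := by
    simp only [div_eq_inv_mul]
    exact (hasFDerivAt_snd.const_mul _).const_add _
  have h3 := hf.hasFDerivAt.comp z (h1.prodMk h2)
  have h4 : HasFDerivAt (fun y => f (rescaleMap P l t₀ y)) _ z := h3
  simp [dirDeriv, h4.fderiv, div_eq_inv_mul]

lemma dX_comp_rescaleMap {f : ℝ × ℝ → F} (hP : ∀ x, HasDerivAt P (P' x) x)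
    (hf : DifferentiableAt ℝ f (rescaleMap P l t₀ z)) :
    ∂ₓ (fun y => f (rescaleMap P l t₀ y)) z = P' z.1 • ∂ₓ f (rescaleMap P l t₀ z) := by
  rw [dirDeriv_comp_rescaleMap hP hf]
  simp only [dirDeriv, ← map_smul]
  simp

lemma dT_comp_rescaleMap {f : ℝ × ℝ → F} (hP : ∀ x, HasDerivAt P (P' x) x)
    (hf : DifferentiableAt ℝ f (rescaleMap P l t₀ z)) :
    ∂ₜ (fun y => f (rescaleMap P l t₀ y)) z = (l ^ 2)⁻¹ • ∂ₜ f (rescaleMap P l t₀ z) := by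
  rw [dirDeriv_comp_rescaleMap hP hf]
  simp only [dirDeriv, ← map_smul]
  simp

lemma dirDeriv_isometry_comp {f : ℝ × ℝ → E} (A : E ≃ₗᵢ[ℝ] E) (c : E) (r : ℝ) (w : ℝ × ℝ)
    (hf : DifferentiableAt ℝ f z) :
    dirDeriv w (fun y => r • (A (f y) + c)) z = r • A (dirDeriv w f z) := by
  have h1 : HasFDerivAt (fun y => A (f y))
      ((A.toContinuousLinearEquiv : E →L[ℝ] E).comp (fderiv ℝ f z)) z :=
    (A.toContinuousLinearEquiv : E →L[ℝ] E).hasFDerivAt.comp z hf.hasFDerivAt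
  have h2 : HasFDerivAt (fun y => r • (A (f y) + c)) _ z := (h1.add_const c).const_smul r
  rw [dirDeriv, h2.fderiv]
  simp [dirDeriv]

variable (G) in
/-- The parabolically rescaled, rigidly moved and reparametrised family of curves. -/
def rescale (A : E ≃ₗᵢ[ℝ] E) (c : E) (P : ℝ → ℝ) (l t₀ : ℝ) (z : ℝ × ℝ) : E :=
  l • (A (G (rescaleMap P l t₀ z)) + c)

variable (h : StripFlow G a b) (hP : ∀ x, HasDerivAt P (P' x) x) (hP0 : ∀ x, 0 < P' x)
  (hl : 0 < l) (A : E ≃ₗᵢ[ℝ] E) (c : E)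
include h hP hl

lemma StripFlow.dX_rescale (hz : z ∈ strip (l ^ 2 * (a - t₀)) (l ^ 2 * (b - t₀))) :
    ∂ₓ (rescale G A c P l t₀) z = (l * P' z.1) • A (∂ₓ G (rescaleMap P l t₀ z)) := by
  have hz' := (rescaleMap_mem_strip (P := P) (a := a) (b := b) hl).2 hz
  have hd := differentiableAt_of_contDiffOn (isOpen_strip a b) h.smooth hz'
  have h1 : DifferentiableAt ℝ (rescaleMap P l t₀) z := by
    refine DifferentiableAt.prodMk ?_ (by fun_prop)
    exact (hP z.1).differentiableAt.comp z differentiableAt_fst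
  have h2 := dirDeriv_isometry_comp (z := z) A c l ((1 : ℝ), (0 : ℝ)) (hd.comp z h1)
  rw [Function.comp_def, dX_comp_rescaleMap hP hd, map_smul, smul_smul] at h2
  exact h2

include hP0

lemma StripFlow.flowSpeed_rescale (hz : z ∈ strip (l ^ 2 * (a - t₀)) (l ^ 2 * (b - t₀))) :
    flowSpeed (rescale G A c P l t₀) z = l * P' z.1 * flowSpeed G (rescaleMap P l t₀ z) := by
  have := mul_pos hl (hP0 z.1)
  rw [flowSpeed, h.dX_rescale hP hl A c hz, norm_smul, A.norm_map, flowSpeed,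
    Real.norm_of_nonneg this.le]

/-- Each arclength derivative of the unit tangent scales by the inverse of the factor `l`. -/
lemma StripFlow.tangentDeriv_rescale (m : ℕ) :
    EqOn (tangentDeriv (rescale G A c P l t₀) m)
      (fun z => ((l ^ m)⁻¹ : ℝ) • (A (tangentDeriv G m (rescaleMap P l t₀ z)) + 0))
      (strip (l ^ 2 * (a - t₀)) (l ^ 2 * (b - t₀))) := by
  have hU := isOpen_strip (l ^ 2 * (a - t₀)) (l ^ 2 * (b - t₀))
  induction m with
  | zero =>
    intro z hz
    have hv := h.flowSpeed_pos ((rescaleMap_mem_strip (P := P) hl).2 hz)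
    have hp := hP0 z.1
    simp only [tangentDeriv, dS, h.flowSpeed_rescale hP hP0 hl A c hz, h.dX_rescale hP hl A c hz,
      map_smul, smul_smul, pow_zero, inv_one, add_zero]
    congr 1
    field_simp
  | succ m ih =>
    intro z hz
    have hz' := (rescaleMap_mem_strip (P := P) (a := a) (b := b) hl).2 hz
    have hv := h.flowSpeed_pos hz'
    have hp := hP0 z.1
    have hd := h.differentiableAt_tangentDeriv m hz'
    have h1 : DifferentiableAt ℝ (rescaleMap P l t₀) z := by
      refine DifferentiableAt.prodMk ?_ (by fun_prop)
      exact (hP z.1).differentiableAt.comp z differentiableAt_fst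
    have h2 := dirDeriv_isometry_comp (z := z) A 0 (l ^ m)⁻¹ ((1 : ℝ), (0 : ℝ)) (hd.comp z h1)
    rw [Function.comp_def, dX_comp_rescaleMap hP hd] at h2
    simp only [tangentDeriv, dS, h.flowSpeed_rescale hP hP0 hl A c hz]
    rw [dirDeriv_congr hU ih hz, h2]
    simp only [map_smul, smul_smul, add_zero]
    congr 1
    field_simp
    ring

lemma StripFlow.rescale (hPs : ContDiff ℝ ∞ P) :
    StripFlow (rescale G A c P l t₀) (l ^ 2 * (a - t₀)) (l ^ 2 * (b - t₀)) := by
  have hmem := fun z hz => (rescaleMap_mem_strip (P := P) (a := a) (b := b) (t₀ := t₀)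
    (z := z) hl).2 hz
  have hΦ : ContDiff ℝ ∞ (rescaleMap P l t₀) := by
    unfold rescaleMap
    fun_prop
  refine ⟨?_, fun z hz => ?_, fun z hz => ?_⟩
  · refine contDiffOn_const.smul (ContDiffOn.add ?_ contDiffOn_const)
    exact (A.toContinuousLinearEquiv : E →L[ℝ] E).contDiff.comp_contDiffOn
      (h.smooth.comp hΦ.contDiffOn hmem)
  · rw [← norm_pos_iff]
    have := h.flowSpeed_rescale hP hP0 hl A c hz
    rw [flowSpeed] at this
    rw [this]
    exact mul_pos (mul_pos hl (hP0 _)) (h.flowSpeed_pos (hmem z hz))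
  · have hd := differentiableAt_of_contDiffOn (isOpen_strip a b) h.smooth (hmem z hz)
    have h2 := dirDeriv_isometry_comp (z := z) A c l ((0 : ℝ), (1 : ℝ))
      (hd.comp z (hΦ.differentiable (by simp) z))
    rw [Function.comp_def, dT_comp_rescaleMap hP hd, h.flow _ (hmem z hz)] at h2
    rw [h.tangentDeriv_rescale hP hP0 hl A c 1 hz]
    refine h2.trans ?_
    simp only [map_smul, smul_smul, add_zero, pow_one]
    congr 1
    field_simp

end Rescale

end Bridge

/-! ### Parametrisation by arclength -/

section Arclength

variable {E : Type*} [NormedAddCommGroup E] [InnerProductSpace ℝ E]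

/-- A periodic immersed curve has a smooth parametrisation by arclength, the inverse of the arclength
function; increasing the arclength by the length of the closed curve adds one period. -/
lemma exists_arclengthParametrisation {c : ℝ → E} {T : ℝ} (hc : ContDiff ℝ ∞ c)
    (hi : ∀ q, deriv c q ≠ 0) (hT : 0 < T) (hper : Function.Periodic c T) (p : ℝ) :
    ∃ P : ℝ → ℝ, IsArclengthParametrisation c p P ∧ P 0 = p ∧ ContDiff ℝ ∞ P ∧
      (∀ x, HasDerivAt P (speed c (P x))⁻¹ x) ∧ ∃ L > 0, ∀ x, P (x + L) = P x + T := by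
  have hv : ContDiff ℝ ∞ (speed c) := (contDiff_infty_iff_deriv.1 hc).2.norm ℝ hi
  have hvper : Function.Periodic (speed c) T := fun q => by
    have h1 : (fun y => c (y + T)) = c := funext hper
    have h2 := deriv_comp_add_const c T q
    rw [h1] at h2
    rw [speed, speed, h2]
  have hvpos : ∀ q, 0 < speed c q := fun q => norm_pos_iff.2 (hi q)
  obtain ⟨m, hm, hmv⟩ : ∃ m > 0, ∀ q, m ≤ speed c q := by
    obtain ⟨y, ⟨q, rfl⟩, hy⟩ :=
      (hvper.compact_of_continuous hT.ne' hv.continuous).exists_isLeast (range_nonempty _)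
    exact ⟨speed c q, hvpos q, fun r => hy ⟨r, rfl⟩⟩
  set s : ℝ → ℝ := fun q => ∫ r in p..q, speed c r with hs
  have hsd : ∀ q, HasDerivAt s (speed c q) q := fun q =>
    (hv.continuous.integral_hasStrictDerivAt p q).hasDerivAt
  have hsderiv : deriv s = speed c := funext fun q => (hsd q).deriv
  have hss : ContDiff ℝ ∞ s := contDiff_infty_iff_deriv.2
    ⟨fun q => (hsd q).differentiableAt, by rwa [hsderiv]⟩
  have hmono : StrictMono s := strictMono_of_deriv_pos fun q => by rw [hsderiv]; exact hvpos q
  have hlin : Monotone fun q => s q - m * q := by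
    have hd : ∀ q, HasDerivAt (fun q => s q - m * q) (speed c q - m * 1) q := fun q =>
      (hsd q).sub ((hasDerivAt_id q).const_mul m)
    refine monotone_of_deriv_nonneg (fun q => (hd q).differentiableAt) fun q => ?_
    rw [(hd q).deriv]
    linarith [hmv q]
  have hsurj : Function.Surjective s := by
    refine hss.continuous.surjective ?_ ?_
    · have h1 : Tendsto (fun q => m * q + (s 0 - m * 0)) atTop atTop :=
        tendsto_atTop_add_const_right _ _ (tendsto_id.const_mul_atTop hm)
      refine tendsto_atTop_mono' _ ?_ h1
      filter_upwards [eventually_ge_atTop 0] with q hq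
      have := hlin hq
      simp only at this
      linarith
    · have h1 : Tendsto (fun q => m * q + (s 0 - m * 0)) atBot atBot :=
        tendsto_atBot_add_const_right _ _ (tendsto_id.const_mul_atBot hm)
      refine tendsto_atBot_mono' _ ?_ h1
      filter_upwards [eventually_le_atBot 0] with q hq
      have := hlin hq
      simp only at this
      linarith
  set e := (hmono.orderIsoOfSurjective s hsurj).toHomeomorph with he
  have hse : ∀ x, s (e.symm x) = x := fun x => e.apply_symm_apply x
  have hshift : ∀ q, s (q + T) = s q + s (p + T) := fun q => by
    have hint : ∀ a b, IntervalIntegrable (speed c) MeasureTheory.volume a b := fun a b =>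
      hv.continuous.intervalIntegrable a b
    have h1 := intervalIntegral.integral_add_adjacent_intervals (hint p q) (hint q (q + T))
    rw [hvper.intervalIntegral_add_eq q p] at h1
    exact h1.symm
  refine ⟨e.symm, hse, ?_, e.contDiff_symm_deriv (f' := speed c) (fun q => (hvpos q).ne') hsd hss,
    fun x => ?_, s (p + T), ?_, fun x => ?_⟩
  · apply hmono.injective
    rw [hse]
    simp [hs]
  · exact HasDerivAt.of_local_left_inverse e.symm.continuous.continuousAt (hsd _) (hvpos _).ne'
      (Eventually.of_forall hse)
  · have h1 : s p = 0 := by simp [hs]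
    rw [← h1]
    exact hmono (by linarith)
  · apply hmono.injective
    rw [hse, hshift (e.symm x), hse]

end Arclength

/-! ### The limit flow -/

section Limit

variable {E : Type*} [NormedAddCommGroup E] [InnerProductSpace ℝ E]

/-- The curvature vector in terms of the first two derivatives of the parametrisation. -/
def curvatureFormula (X Y : E) : E := (‖X‖ ^ 2)⁻¹ • Y - (⟪X, Y⟫ / ‖X‖ ^ 4) • X

lemma curvatureVector_eq {c c' : ℝ → E} {c'' : E} {p : ℝ} (hc : ∀ q, HasDerivAt c (c' q) q)
    (hc' : HasDerivAt c' c'' p) (h0 : c' p ≠ 0) :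
    curvatureVector c p = curvatureFormula (c' p) c'' := by
  have hd : deriv c = c' := funext fun q => (hc q).deriv
  have hN0 : ‖c' p‖ ≠ 0 := norm_ne_zero_iff.2 h0
  have hN : HasDerivAt (fun q => ‖c' q‖) (⟪c' p, c''⟫ / ‖c' p‖) p := by
    have h1 : DifferentiableAt ℝ (fun q => ‖c' q‖) p := hc'.differentiableAt.norm ℝ h0
    have h2 := hc'.norm_sq
    have h3 := (h1.hasDerivAt.pow 2).unique h2
    have h4 : deriv (fun q => ‖c' q‖) p = ⟪c' p, c''⟫ / ‖c' p‖ := by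
      rw [eq_div_iff hN0]
      simp only [Nat.cast_ofNat, Nat.add_one_sub_one, pow_one] at h3
      linarith
    rw [← h4]
    exact h1.hasDerivAt
  have hT : HasDerivAt (fun q => ‖c' q‖⁻¹ • c' q) _ p := (hN.inv hN0).smul hc'
  have hu : unitTangent c = fun q => ‖c' q‖⁻¹ • c' q := by
    funext q
    simp [unitTangent, arcDeriv, speed, hd]
  rw [curvatureVector, arcDeriv, hu, hT.deriv, speed, hd, curvatureFormula]
  simp only [smul_add, smul_smul, sub_eq_add_neg, ← neg_smul]
  congr 1
  · congr 1
    rw [sq, mul_inv]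
    rfl
  · congr 1
    field_simp

lemma tendsto_curvatureFormula {X Y : ℕ → E} {X₀ Y₀ : E} (hX : Tendsto X atTop (𝓝 X₀))
    (hY : Tendsto Y atTop (𝓝 Y₀)) (h0 : X₀ ≠ 0) :
    Tendsto (fun j => curvatureFormula (X j) (Y j)) atTop (𝓝 (curvatureFormula X₀ Y₀)) := by
  have hN : ‖X₀‖ ≠ 0 := norm_ne_zero_iff.2 h0
  exact (((hX.norm.pow 2).inv₀ (pow_ne_zero 2 hN)).smul hY).sub
    (((hX.inner hY).div (hX.norm.pow 4) (pow_ne_zero 4 hN)).smul hX)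

/-- The space-time domain `ℝ × (-∞, 0]` of an ancient flow. -/
def ancientDomain : Set (ℝ × ℝ) := univ ×ˢ Iic 0

lemma uniqueDiffOn_ancientDomain : UniqueDiffOn ℝ ancientDomain :=
  uniqueDiffOn_univ.prod (uniqueDiffOn_Iic 0)

lemma convex_ancientDomain : Convex ℝ ancientDomain := convex_univ.prod (convex_Iic 0)

variable {F : Type*} [NormedAddCommGroup F] [NormedSpace ℝ F]

lemma hasDerivAt_fst_slice_within {u : ℝ × ℝ → F} {x t : ℝ} (ht : t ≤ 0)
    (hu : DifferentiableWithinAt ℝ u ancientDomain (x, t)) :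
    HasDerivAt (fun q => u (q, t)) (fderivWithin ℝ u ancientDomain (x, t) (1, 0)) x := by
  have h1 : HasDerivWithinAt (fun q : ℝ => (q, t)) (1, 0) univ x :=
    ((hasDerivAt_id x).prodMk (hasDerivAt_const x t)).hasDerivWithinAt
  exact hasDerivWithinAt_univ.1 (hu.hasFDerivWithinAt.comp_hasDerivWithinAt x h1
    (show MapsTo (fun q : ℝ => (q, t)) univ ancientDomain from fun q _ => ⟨mem_univ _, ht⟩))

lemma hasDerivWithinAt_snd_slice {u : ℝ × ℝ → F} {x t : ℝ}
    (hu : DifferentiableWithinAt ℝ u ancientDomain (x, t)) :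
    HasDerivWithinAt (fun s => u (x, s)) (fderivWithin ℝ u ancientDomain (x, t) (0, 1))
      (Iic 0) t := by
  have h1 : HasDerivWithinAt (fun s : ℝ => (x, s)) (0, 1) (Iic 0) t :=
    ((hasDerivAt_const t x).prodMk (hasDerivAt_id t)).hasDerivWithinAt
  exact hu.hasFDerivWithinAt.comp_hasDerivWithinAt t h1
    (show MapsTo (fun s : ℝ => (x, s)) (Iic 0) ancientDomain from fun s hs => ⟨mem_univ _, hs⟩)

lemma hasDerivAt_fderivWithin_slice {u : ℝ × ℝ → F} {x t : ℝ} (ht : t ≤ 0)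
    (hu : ContDiffWithinAt ℝ ∞ u ancientDomain (x, t)) :
    HasDerivAt (fun q => fderivWithin ℝ u ancientDomain (q, t) (1, 0))
      (fderivWithin ℝ (fderivWithin ℝ u ancientDomain) ancientDomain (x, t) (1, 0) (1, 0)) x := by
  have h1 : ContDiffWithinAt ℝ ∞ (fderivWithin ℝ u ancientDomain) ancientDomain (x, t) :=
    hu.fderivWithin_right uniqueDiffOn_ancientDomain (by simp) ⟨mem_univ _, ht⟩
  have h2 := hasDerivAt_fst_slice_within ht (h1.differentiableWithinAt (by simp))
  simpa using h2.clm_apply (hasDerivAt_const x ((1 : ℝ), (0 : ℝ)))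

lemma SmoothlyConvergesOn.tendsto_fderivWithin {f : ℕ → ℝ × ℝ → F} {g : ℝ × ℝ → F}
    (h : SmoothlyConvergesOn f g ancientDomain) {z : ℝ × ℝ} (hz : z ∈ ancientDomain) (w : ℝ × ℝ) :
    Tendsto (fun j => fderivWithin ℝ (f j) ancientDomain z w) atTop
      (𝓝 (fderivWithin ℝ g ancientDomain z w)) := by
  have h1 := (h 1 {z} (by simpa using hz) isCompact_singleton).tendsto_at (mem_singleton z)
  have h2 := ((ContinuousMultilinearMap.apply ℝ (fun _ : Fin 1 => ℝ × ℝ) F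
    fun _ => w).continuous.tendsto _).comp h1
  simpa [Function.comp_def, iteratedFDerivWithin_one_apply (uniqueDiffOn_ancientDomain z hz)] using h2

lemma SmoothlyConvergesOn.tendsto_fderivWithin_two {f : ℕ → ℝ × ℝ → F} {g : ℝ × ℝ → F}
    (h : SmoothlyConvergesOn f g ancientDomain) {z : ℝ × ℝ} (hz : z ∈ ancientDomain) (w : ℝ × ℝ) :
    Tendsto (fun j => fderivWithin ℝ (fderivWithin ℝ (f j) ancientDomain) ancientDomain z w w) atTop
      (𝓝 (fderivWithin ℝ (fderivWithin ℝ g ancientDomain) ancientDomain z w w)) := by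
  have h1 := (h 2 {z} (by simpa using hz) isCompact_singleton).tendsto_at (mem_singleton z)
  have h2 := ((ContinuousMultilinearMap.apply ℝ (fun _ : Fin 2 => ℝ × ℝ) F
    fun _ => w).continuous.tendsto _).comp h1
  simpa [Function.comp_def, iteratedFDerivWithin_two_apply _ uniqueDiffOn_ancientDomain hz] using h2

lemma curvatureVector_slice_within {g : ℝ × ℝ → E} {x t : ℝ} (ht : t ≤ 0)
    (hg : ∀ q, ContDiffWithinAt ℝ ∞ g ancientDomain (q, t))
    (h0 : fderivWithin ℝ g ancientDomain (x, t) (1, 0) ≠ 0) :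
    curvatureVector (fun q => g (q, t)) x =
      curvatureFormula (fderivWithin ℝ g ancientDomain (x, t) (1, 0))
        (fderivWithin ℝ (fderivWithin ℝ g ancientDomain) ancientDomain (x, t) (1, 0) (1, 0)) := by
  refine curvatureVector_eq (c' := fun q => fderivWithin ℝ g ancientDomain (q, t) (1, 0))
    (fun q => hasDerivAt_fst_slice_within ht ((hg q).differentiableWithinAt (by simp))) (hasDerivAt_fderivWithin_slice ht (hg x)) h0

/-- Backwards in time the length element grows. -/
lemma StripFlow.one_le_flowSpeed {G : ℝ × ℝ → E} {a b : ℝ} (h : StripFlow G a b) (hb : 0 < b)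
    {x t : ℝ} (hunit : flowSpeed G (x, 0) = 1) (ha : a < t) (ht : t ≤ 0) :
    1 ≤ flowSpeed G (x, t) := by
  have hmem : ∀ s ∈ Icc t 0, (x, s) ∈ strip a b := fun s hs =>
    mem_strip.2 ⟨ha.trans_le hs.1, hs.2.trans_lt hb⟩
  have hd : ∀ s ∈ Icc t 0, HasDerivAt (fun s => flowSpeed G (x, s)) (∂ₜ (flowSpeed G) (x, s)) s :=
    fun s hs => hasDerivAt_snd_slice (differentiableAt_of_contDiffOn (isOpen_strip a b)
      h.contDiffOn_flowSpeed (hmem s hs))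
  have hanti : AntitoneOn (fun s => flowSpeed G (x, s)) (Icc t 0) := by
    refine antitoneOn_of_deriv_nonpos (convex_Icc t 0)
      (fun s hs => (hd s hs).continuousAt.continuousWithinAt)
      (fun s hs => (hd s (interior_subset hs)).differentiableAt.differentiableWithinAt)
      fun s hs => ?_
    have hs' := hmem s (interior_subset hs)
    rw [(hd s (interior_subset hs)).deriv, h.dT_flowSpeed hs']
    have := h.flowSpeed_pos hs'
    nlinarith [mul_nonneg (sq_nonneg ‖tangentDeriv G 1 (x, s)‖) this.le]
  rw [← hunit]
  exact hanti (left_mem_Icc.2 ht) (right_mem_Icc.2 ht) ht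

/-- A curve with nonzero curvature at some point is not contained in a line. -/
lemma not_collinear_range {c c' : ℝ → E} {c'' : E} {p : ℝ} (hc : ∀ q, HasDerivAt c (c' q) q)
    (hc' : HasDerivAt c' c'' p) (h0 : c' p ≠ 0) (hk : curvatureVector c p ≠ 0)
    (horth : ⟪c' p, curvatureVector c p⟫ = 0) : ¬ Collinear ℝ (range c) := by
  intro hcol
  obtain ⟨p₀, v, hv⟩ := (collinear_iff_exists_forall_eq_smul_vadd _).1 hcol
  have hcv := curvatureVector_eq hc hc' h0
  set k := curvatureVector c p with hk_def
  have key : ∀ u : E, ⟪u, v⟫ = 0 → ⟪u, c' p⟫ = 0 ∧ ⟪u, k⟫ = 0 := by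
    intro u hu
    have h1 : (fun q => ⟪u, c q⟫) = fun _ => ⟪u, p₀⟫ := by
      funext q
      obtain ⟨r, hr⟩ := hv (c q) ⟨q, rfl⟩
      simp [hr, inner_add_right, inner_smul_right, hu]
    have h2 : (fun q => ⟪u, c' q⟫) = fun _ => (0 : ℝ) := by
      funext q
      have h3 := (hasDerivAt_const q u).inner ℝ (hc q)
      rw [h1] at h3
      simpa using h3.unique (hasDerivAt_const q _)
    have h4 : ⟪u, c''⟫ = 0 := by
      have h3 := (hasDerivAt_const p u).inner ℝ hc'
      rw [h2] at h3
      simpa using h3.unique (hasDerivAt_const p _)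
    have h5 : ⟪u, c' p⟫ = 0 := congrFun h2 p
    refine ⟨h5, ?_⟩
    rw [hcv, curvatureFormula, inner_sub_right, inner_smul_right, inner_smul_right, h4, h5]
    simp
  -- The combination of the tangent and the curvature vector that is orthogonal to the line.
  have h6 := key (⟪k, v⟫ • c' p - ⟪c' p, v⟫ • k) (by
    simp only [inner_sub_left, inner_smul_left, conj_trivial]; ring)
  have h7 : ⟪c' p, v⟫ = 0 := by
    have := h6.2
    simp only [inner_sub_left, inner_smul_left, conj_trivial, horth, mul_zero, zero_sub,
      neg_eq_zero, mul_eq_zero, inner_self_eq_zero] at this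
    exact this.resolve_right hk
  exact h0 (inner_self_eq_zero.1 (key (c' p) h7).1)

end Limit

namespace NormalisedFlows

open Metric

variable {n : ℕ} {G : ℕ → ℝ × ℝ → EuclideanSpace ℝ (Fin n)} {a b : ℕ → ℝ}

/-- A sequence of normalised flows with a common nonzero curvature vector at the origin
subconverges smoothly to an ancient flow that does not start from a line. -/
theorem exists_limit (h : NormalisedFlows G a b) {e₁ e₂ : EuclideanSpace ℝ (Fin n)}
    (he₁ : ∀ j, tangentDeriv (G j) 0 (0, 0) = e₁) (he₂ : ∀ j, tangentDeriv (G j) 1 (0, 0) = e₂)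
    (hne : e₂ ≠ 0) :
    ∃ (φ : ℕ → ℕ) (Γ : ℝ → ℝ → EuclideanSpace ℝ (Fin n)), StrictMono φ ∧ IsFlow Γ (Iic 0) ∧
      SmoothlyConvergesOn (fun j => G (φ j)) (fun z => Γ z.1 z.2) (univ ×ˢ Iic 0) ∧
      ¬ Collinear ℝ (range fun x => Γ x 0) := by
  have hslab : ∀ R : ℝ, ancientDomain ∩ closedBall 0 R ⊆ slab R := by
    rintro R z ⟨hz, hzR⟩
    have h1 : ‖z‖ ≤ R := mem_closedBall_zero_iff.1 hzR
    have h2 := abs_le.1 ((norm_fst_le z).trans h1)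
    have h3 := abs_le.1 ((norm_snd_le z).trans h1)
    exact ⟨h2, h3.1, hz.2⟩
  have hstrip : ∀ z ∈ ancientDomain, ∀ᶠ j in atTop, z ∈ strip (a j) (b j) := fun z hz => by
    filter_upwards [h.slab_subset ‖z‖] with j hj
    exact hj (hslab _ ⟨hz, by simp⟩)
  have hat : ∀ j, ∀ z ∈ strip (a j) (b j), ContDiffAt ℝ ∞ (G j) z := fun j z hz =>
    (h.flow j).smooth.contDiffAt ((isOpen_strip _ _).mem_nhds hz)
  obtain ⟨φ, hφ, g, hg, hconv⟩ := exists_subseq_smoothlyConvergesOn convex_ancientDomain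
    ⟨0, mem_univ _, le_refl (0 : ℝ)⟩ uniqueDiffOn_ancientDomain G
    (fun R => by
      filter_upwards [h.slab_subset R] with j hj z hz
      exact (hat j z (hj (hslab R hz))).contDiffWithinAt)
    (fun k R => by
      obtain ⟨C, hC⟩ := h.locBdd_iteratedFDeriv_position k R
      refine ⟨C, ?_⟩
      filter_upwards [h.slab_subset R, hC] with j hj hj2 z hz
      rw [iteratedFDerivWithin_eq_iteratedFDeriv uniqueDiffOn_ancientDomain
        ((hat j z (hj (hslab R hz))).of_le (by exact_mod_cast le_top)) hz.1]
      exact hj2 z (hslab R hz))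
  have hφt := hφ.tendsto_atTop
  have hfd : ∀ j, ∀ z ∈ ancientDomain, z ∈ strip (a j) (b j) → ∀ w,
      fderivWithin ℝ (G j) ancientDomain z w = dirDeriv w (G j) z := fun j z hz hz' w => by
    rw [((hat j z hz').differentiableAt (by simp)).fderivWithin (uniqueDiffOn_ancientDomain z hz)]
    rfl
  have hspeed : ∀ z ∈ ancientDomain, 1 ≤ ‖fderivWithin ℝ g ancientDomain z (1, 0)‖ := by
    intro z hz
    refine ge_of_tendsto (hconv.tendsto_fderivWithin hz (1, 0)).norm ?_
    filter_upwards [hφt.eventually (hstrip z hz)] with j hj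
    rw [hfd _ z hz hj]
    exact (h.flow _).one_le_flowSpeed (h.pos _) (h.unit _ _) (mem_strip.1 hj).1 hz.2
  have hne0 : ∀ z ∈ ancientDomain, fderivWithin ℝ g ancientDomain z (1, 0) ≠ 0 := fun z hz h0 => by
    have := hspeed z hz
    rw [h0, norm_zero] at this
    linarith
  have hgd : ∀ z ∈ ancientDomain, DifferentiableWithinAt ℝ g ancientDomain z := fun z hz =>
    (hg z hz).differentiableWithinAt (by simp)
  have hmem : ∀ (x : ℝ) {t : ℝ}, t ≤ 0 → (x, t) ∈ ancientDomain := fun x t ht => ⟨mem_univ _, ht⟩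
  have hcurv : ∀ (x t : ℝ), t ≤ 0 → fderivWithin ℝ g ancientDomain (x, t) (0, 1) =
      curvatureVector (fun q => g (q, t)) x := by
    intro x t ht
    have hz := hmem x ht
    rw [curvatureVector_slice_within ht (fun q => hg _ (hmem q ht)) (hne0 _ hz)]
    refine tendsto_nhds_unique (hconv.tendsto_fderivWithin hz (0, 1)) ?_
    refine (tendsto_curvatureFormula (hconv.tendsto_fderivWithin hz (1, 0))
      (hconv.tendsto_fderivWithin_two hz (1, 0)) (hne0 _ hz)).congr' ?_
    filter_upwards [hφt.eventually (hstrip _ hz)] with j hj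
    have hj' : ∀ q, (q, t) ∈ strip (a (φ j)) (b (φ j)) := fun q => mem_strip.2 (mem_strip.1 hj)
    have h1 := curvatureVector_slice_within (g := G (φ j)) (x := x) ht
      (fun q => (hat _ _ (hj' q)).contDiffWithinAt)
      (by rw [hfd _ _ hz hj]; exact (h.flow _).immersed _ hj)
    rw [← h1, hfd _ _ hz hj, (h.flow (φ j)).flow _ hj]
    exact curvatureVector_slice (z := (x, t)) (h.flow (φ j)).smooth (h.flow (φ j)).immersed hj
  have hz0 := hmem 0 le_rfl
  have h00 : ∀ j, ((0 : ℝ), (0 : ℝ)) ∈ strip (a j) (b j) := fun j =>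
    mem_strip.2 ⟨h.neg j, h.pos j⟩
  have htan : fderivWithin ℝ g ancientDomain (0, 0) (1, 0) = e₁ := by
    refine tendsto_nhds_unique (hconv.tendsto_fderivWithin hz0 (1, 0)) ?_
    refine tendsto_const_nhds.congr fun j => ?_
    rw [hfd _ _ hz0 (h00 _), (h.flow (φ j)).dX_eq (h00 _), h.unit, one_smul, ← he₁ (φ j)]
    rfl
  have hcur : fderivWithin ℝ g ancientDomain (0, 0) (0, 1) = e₂ := by
    refine tendsto_nhds_unique (hconv.tendsto_fderivWithin hz0 (0, 1)) ?_
    refine tendsto_const_nhds.congr fun j => ?_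
    rw [hfd _ _ hz0 (h00 _), (h.flow (φ j)).flow _ (h00 _), he₂]
  refine ⟨φ, fun x t => g (x, t), hφ, ⟨hg, fun t ht x => ?_, fun t ht x => ?_⟩, hconv, ?_⟩
  · rw [(hasDerivAt_fst_slice_within ht (hgd _ (hmem x ht))).deriv]
    exact hne0 _ (hmem x ht)
  · rw [← hcurv x t ht]
    exact hasDerivWithinAt_snd_slice (hgd _ (hmem x ht))
  · refine not_collinear_range (p := 0)
      (fun q => hasDerivAt_fst_slice_within le_rfl (hgd _ (hmem q le_rfl)))
      (hasDerivAt_fderivWithin_slice le_rfl (hg _ hz0)) (hne0 _ hz0) ?_ ?_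
    · rw [← hcurv 0 0 le_rfl, hcur]
      exact hne
    · rw [← hcurv 0 0 le_rfl, hcur, htan, ← he₁ 0, ← he₂ 0]
      exact (h.flow 0).inner_tangent_curvature (h00 0)

end NormalisedFlows

/-! ### The rescaled flows -/

section BlowUp

variable {n : ℕ} {Ω : ℝ} {γ : ℝ → ℝ → EuclideanSpace ℝ (Fin n)}

lemma IsClosedFlow.stripPeriodic (hγ : IsClosedFlow γ (Ico 0 Ω)) :
    StripPeriodic (fun z => γ z.1 z.2) 0 Ω (2 * Real.pi) := fun z hz =>
  hγ.periodic z.2 (Ioo_subset_Ico_self (mem_strip.1 hz)) z.1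

lemma IsClosedFlow.curvature_eq (hγ : IsClosedFlow γ (Ico 0 Ω)) {z : ℝ × ℝ} (hz : z ∈ strip 0 Ω) :
    curvature (fun q => γ q z.2) z.1 = ‖tangentDeriv (fun z => γ z.1 z.2) 1 z‖ := by
  rw [curvature]
  congr 1
  exact curvatureVector_slice (G := fun z => γ z.1 z.2) hγ.stripFlow.smooth hγ.stripFlow.immersed hz

lemma IsClosedFlow.sq_curvature_le (hγ : IsClosedFlow γ (Ico 0 Ω)) {z : ℝ × ℝ}
    (hz : z ∈ strip 0 Ω) :
    ‖tangentDeriv (fun z => γ z.1 z.2) 1 z‖ ^ 2 ≤ maxSqCurvature γ z.2 := by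
  have hz' : ∀ q, (q, z.2) ∈ strip 0 Ω := fun q => mem_strip.2 (mem_strip.1 hz)
  have h1 : (fun q => curvature (fun q => γ q z.2) q ^ 2) =
      fun q => ‖tangentDeriv (fun z => γ z.1 z.2) 1 (q, z.2)‖ ^ 2 :=
    funext fun q => by rw [hγ.curvature_eq (hz' q)]
  have hcont : Continuous fun q => ‖tangentDeriv (fun z => γ z.1 z.2) 1 (q, z.2)‖ ^ 2 :=
    continuous_iff_continuousAt.2 fun q => ((hasDerivAt_fst_slice
      (hγ.stripFlow.differentiableAt_tangentDeriv 1 (hz' q))).continuousAt.norm.pow 2)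
  have hper : Function.Periodic (fun q => ‖tangentDeriv (fun z => γ z.1 z.2) 1 (q, z.2)‖ ^ 2)
      (2 * Real.pi) := fun q => by
    simp only [StripFlow.stripPeriodic_tangentDeriv hγ.stripPeriodic 1 (q, z.2) (hz' q)]
  -- Boundedness matters here: the supremum of an unbounded set would be `0`.
  have hbdd := (hper.compact_of_continuous Real.two_pi_pos.ne' hcont).bddAbove
  rw [maxSqCurvature, h1]
  exact le_ciSup hbdd z.1

/-- The curvature at an essential blow-up point controls the curvature at all earlier times, and
by continuity at the blow-up time itself. -/
lemma IsClosedFlow.mul_sq_curvature_le (hγ : IsClosedFlow γ (Ico 0 Ω)) {ρ t₀ K : ℝ} (hρ : 0 < ρ)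
    (ht₀ : t₀ < Ω) (hK : ∀ τ, 0 ≤ τ → τ < t₀ → ρ * maxSqCurvature γ τ ≤ K)
    {z : ℝ × ℝ} (hz : 0 < z.2) (hzt : z.2 ≤ t₀) :
    ρ * ‖tangentDeriv (fun z => γ z.1 z.2) 1 z‖ ^ 2 ≤ K := by
  have hlt : ∀ z : ℝ × ℝ, 0 < z.2 → z.2 < t₀ →
      ρ * ‖tangentDeriv (fun z => γ z.1 z.2) 1 z‖ ^ 2 ≤ K := fun z h1 h2 =>
    (mul_le_mul_of_nonneg_left (hγ.sq_curvature_le (mem_strip.2 ⟨h1, h2.trans ht₀⟩)) hρ.le).trans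
      (hK z.2 h1.le h2)
  rcases hzt.lt_or_eq with h | h
  · exact hlt z hz h
  have hd := hasDerivAt_snd_slice (x := z.1) (t := z.2)
    (hγ.stripFlow.differentiableAt_tangentDeriv 1 (mem_strip.2 ⟨hz, h.trans_lt ht₀⟩))
  have hc : Tendsto (fun s => ρ * ‖tangentDeriv (fun z => γ z.1 z.2) 1 (z.1, s)‖ ^ 2) (𝓝[<] z.2)
      (𝓝 (ρ * ‖tangentDeriv (fun z => γ z.1 z.2) 1 z‖ ^ 2)) :=
    (((hd.continuousAt.norm.pow 2).const_mul ρ).tendsto).mono_left nhdsWithin_le_nhds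
  refine le_of_tendsto hc ?_
  filter_upwards [Ioo_mem_nhdsLT hz] with s hs
  exact hlt (z.1, s) hs.1 (by simpa [h] using hs.2)

variable {p t : ℕ → ℝ} {A : ℕ → EuclideanSpace ℝ (Fin n) ≃ₗᵢ[ℝ] EuclideanSpace ℝ (Fin n)}
  {b : ℕ → EuclideanSpace ℝ (Fin n)}

/-- The beginning of the time interval of the rescaled flow. -/
def initialTime (γ : ℝ → ℝ → EuclideanSpace ℝ (Fin n)) (p t : ℕ → ℝ) (j : ℕ) : ℝ :=
  scale γ p t j ^ 2 * (0 - t j)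

/-- The end of the time interval of the rescaled flow. -/
def finalTime (γ : ℝ → ℝ → EuclideanSpace ℝ (Fin n)) (Ω : ℝ) (p t : ℕ → ℝ)
    (j : ℕ) : ℝ :=
  scale γ p t j ^ 2 * (Ω - t j)

/-- A periodic flow on a time interval around `0` whose curvature squared is at most `M` at
nonpositive times, and whose curve at time `0` is parametrised by arclength and has position `0`,
unit tangent `e₁` and curvature vector `e₂ ≠ 0` at the parameter `0`. -/
structure NormalisedClosedFlow (G : ℝ × ℝ → EuclideanSpace ℝ (Fin n)) (a b M : ℝ) : Prop where
  flow : StripFlow G a b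
  unit : ∀ x, flowSpeed G (x, 0) = 1
  base : G (0, 0) = 0
  tangent : tangentDeriv G 0 (0, 0) = stdVector n 0
  curvature : tangentDeriv G 1 (0, 0) = stdVector n 1
  curvature_ne : stdVector n 1 ≠ 0
  periodic : ∃ L > 0, StripPeriodic G a b L
  bound : ∀ z : ℝ × ℝ, a < z.2 → z.2 ≤ 0 → ‖tangentDeriv G 1 z‖ ^ 2 ≤ M

/-- The rescaled flow, parametrised by arclength at time `0`. -/
lemma exists_arclength_rescaledFlow (hγ : IsClosedFlow γ (Ico 0 Ω)) (hAb : IsNormalised γ p t A b)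
    {ρ : ℝ} (hρ : 0 < ρ) (j : ℕ) (ht0 : 0 < t j) (htΩ : t j < Ω) (hl : 0 < scale γ p t j)
    (hess : ∀ τ : ℝ, 0 ≤ τ → τ < t j →
      ρ * maxSqCurvature γ τ ≤ curvature (fun q => γ q (t j)) (p j) ^ 2) :
    ∃ P : ℝ → ℝ,
      IsArclengthParametrisation (fun q => rescaledFlow γ p t A b j q 0) (p j) P ∧
      NormalisedClosedFlow (fun z => rescaledFlow γ p t A b j (P z.1) z.2)
        (initialTime γ p t j) (finalTime γ Ω p t j) ρ⁻¹ := by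
  set l := scale γ p t j with hl_def
  set H : ℝ × ℝ → EuclideanSpace ℝ (Fin n) := fun z => γ z.1 z.2 with hH
  have hl2 : 0 < l ^ 2 := by positivity
  have hflow : StripFlow H 0 Ω := hγ.stripFlow
  have hid : ∀ x : ℝ, HasDerivAt (fun x : ℝ => x) ((fun _ => (1 : ℝ)) x) x := fun x => hasDerivAt_id x
  set F := rescale H (A j) (b j) (fun x => x) l (t j) with hF
  have hFflow : StripFlow F (initialTime γ p t j) (finalTime γ Ω p t j) :=
    hflow.rescale hid (fun _ => one_pos) hl (A j) (b j) contDiff_id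
  have hz0 : ∀ q : ℝ, (q, (0 : ℝ)) ∈ strip (initialTime γ p t j) (finalTime γ Ω p t j) := fun q =>
    mem_strip.2 ⟨mul_neg_of_pos_of_neg hl2 (by linarith), mul_pos hl2 (by linarith)⟩
  set c : ℝ → EuclideanSpace ℝ (Fin n) := fun q => rescaledFlow γ p t A b j q 0 with hc
  have hcs : ContDiff ℝ ∞ c := contDiff_iff_contDiffAt.2 fun q =>
    (hFflow.smooth.contDiffAt ((isOpen_strip _ _).mem_nhds (hz0 q))).comp q
      (f := fun q : ℝ => (q, (0 : ℝ))) (contDiffAt_id.prodMk contDiffAt_const)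
  have hspeed : ∀ q, speed c q = flowSpeed F (q, 0) := fun q =>
    speed_slice (z := (q, 0)) hFflow.smooth (hz0 q)
  have hcper : Function.Periodic c (2 * Real.pi) := fun q => by
    have h1 : γ (q + 2 * Real.pi) (t j + 0 / l ^ 2) = γ q (t j + 0 / l ^ 2) :=
      hγ.periodic (t j + 0 / l ^ 2) (by simp [ht0.le, htΩ]) q
    simp only [hc, rescaledFlow, ← hl_def, h1]
  obtain ⟨P, hPa, hP0, hPs, hPd, L, hL, hPL⟩ := exists_arclengthParametrisation hcs
    (fun q => by
      rw [← norm_pos_iff]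
      have := hFflow.flowSpeed_pos (hz0 q)
      rwa [← hspeed q] at this) Real.two_pi_pos hcper (p j)
  have hvpos : ∀ q, 0 < speed c q := fun q => by
    rw [hspeed]; exact hFflow.flowSpeed_pos (hz0 q)
  have hP' : ∀ x, 0 < (speed c (P x))⁻¹ := fun x => inv_pos.2 (hvpos _)
  refine ⟨P, hPa, ?_⟩
  set G := rescale H (A j) (b j) P l (t j) with hG
  have hGflow : StripFlow G (initialTime γ p t j) (finalTime γ Ω p t j) :=
    hflow.rescale hPd hP' hl (A j) (b j) hPs
  have hGT := fun m => hflow.tangentDeriv_rescale (t₀ := t j) hPd hP' hl (A j) (b j) m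
  have hFT := fun m => hflow.tangentDeriv_rescale (t₀ := t j) hid (fun _ => one_pos) hl (A j) (b j) m
  -- At the base point, both parametrisations have the same geometric derivatives.
  have hbase : rescaleMap P l (t j) (0, 0) = rescaleMap (fun x => x) l (t j) (p j, 0) := by
    simp [rescaleMap, hP0]
  have hGF : ∀ m, tangentDeriv G m (0, 0) = tangentDeriv F m (p j, 0) := fun m => by
    rw [hGT m (hz0 0), hFT m (hz0 (p j))]
    simp only [hbase]
  obtain ⟨n0, n1, n2⟩ := hAb j hl
  have hk : ‖tangentDeriv F 1 (p j, 0)‖ = 1 := by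
    have h1 : rescaleMap (fun x => x) l (t j) (p j, 0) = (p j, t j) := by simp [rescaleMap]
    have h2 : l = ‖tangentDeriv H 1 (p j, t j)‖ :=
      hγ.curvature_eq (z := (p j, t j)) (mem_strip.2 ⟨ht0, htΩ⟩)
    rw [hFT 1 (hz0 (p j))]
    simp only [h1, add_zero, norm_smul, LinearIsometryEquiv.norm_map, ← h2, pow_one, norm_inv,
      Real.norm_of_nonneg hl.le]
    exact inv_mul_cancel₀ hl.ne'
  have hGT1 : tangentDeriv G 1 (0, 0) = stdVector n 1 := by
    have h1 : curvatureVector (fun q => F (q, 0)) (p j) = tangentDeriv F 1 (p j, 0) :=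
      curvatureVector_slice (z := (p j, 0)) hFflow.smooth hFflow.immersed (hz0 (p j))
    have h2 : curvatureVector c (p j) = tangentDeriv F 1 (p j, 0) := h1
    have h3 : (‖curvatureVector c (p j)‖)⁻¹ • curvatureVector c (p j) = stdVector n 1 := n2
    rw [hGF, ← h3, h2, hk, inv_one, one_smul]
  have hne : stdVector n 1 ≠ 0 := by
    rw [← hGT1, hGF, ← norm_pos_iff, hk]
    exact one_pos
  suffices key : NormalisedClosedFlow G (initialTime γ p t j) (finalTime γ Ω p t j) ρ⁻¹ from key
  refine ⟨hGflow, fun x => ?_, ?_, ?_, hGT1, hne, ⟨L, hL, fun z hz => ?_⟩, fun z hz hz' => ?_⟩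
  · have h1 := hflow.flowSpeed_rescale (t₀ := t j) hPd hP' hl (A j) (b j) (hz0 x)
    have h2 := hflow.flowSpeed_rescale (t₀ := t j) hid (fun _ => one_pos) hl (A j) (b j) (hz0 (P x))
    have h3 : flowSpeed F (P x, 0) = l * flowSpeed H (rescaleMap P l (t j) (x, 0)) := by
      rw [hF, h2, mul_one]
      rfl
    rw [hG, h1, hspeed, h3]
    have h4 := hFflow.flowSpeed_pos (hz0 (P x))
    rw [h3] at h4
    have h5 := pos_of_mul_pos_right h4 hl.le
    field_simp
  · have h1 : G (0, 0) = rescaledFlow γ p t A b j (P 0) 0 := rfl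
    rw [h1, hP0, n0]
  · rw [hGF, ← n1]
    exact (unitTangent_slice (z := (p j, 0)) hFflow.smooth (hz0 (p j))).symm
  · have h1 := (rescaleMap_mem_strip (P := P) (a := 0) (b := Ω) (t₀ := t j) hl).2 hz
    have h2 : H (P z.1 + 2 * Real.pi, t j + z.2 / l ^ 2) = H (P z.1, t j + z.2 / l ^ 2) :=
      hγ.stripPeriodic _ h1
    change l • (A j (H (P (z.1 + L), t j + z.2 / l ^ 2)) + b j) =
      l • (A j (H (P z.1, t j + z.2 / l ^ 2)) + b j)
    rw [hPL, h2]
  · have hzs : z ∈ strip (initialTime γ p t j) (finalTime γ Ω p t j) :=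
      mem_strip.2 ⟨hz, hz'.trans_lt (mem_strip.1 (hz0 0)).2⟩
    have h1 := (rescaleMap_mem_strip (P := P) (a := 0) (b := Ω) (t₀ := t j) hl).2 hzs
    have h2 := hγ.mul_sq_curvature_le hρ htΩ hess (z := rescaleMap P l (t j) z)
      (mem_strip.1 h1).1 (by
        have : z.2 / l ^ 2 ≤ 0 := div_nonpos_of_nonpos_of_nonneg hz' hl2.le
        simp only [rescaleMap]
        linarith)
    have h3 : curvature (fun q => γ q (t j)) (p j) = l := rfl
    rw [h3] at h2
    rw [hGT 1 hzs]
    simp only [add_zero, norm_smul, LinearIsometryEquiv.norm_map, pow_one, norm_inv,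
      Real.norm_of_nonneg hl.le, mul_pow, inv_pow]
    rw [inv_mul_le_iff₀ hl2, ← div_eq_mul_inv, le_div_iff₀ hρ, mul_comm]
    exact h2

end BlowUp

end CurveShortening

end

theorem mainTheorem5 (n : ℕ) (ω : ℝ) (γ : ℝ → ℝ → EuclideanSpace ℝ (Fin n))
    (hγ : CurveShortening.IsClosedFlow γ (Set.Ico 0 ω))
    (p t : ℕ → ℝ) (hpt : CurveShortening.IsEssentialBlowUpSequence γ ω p t)
    (A : ℕ → EuclideanSpace ℝ (Fin n) ≃ₗᵢ[ℝ] EuclideanSpace ℝ (Fin n))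
    (b : ℕ → EuclideanSpace ℝ (Fin n))
    (hAb : CurveShortening.IsNormalised γ p t A b) :
    ∃ (φ : ℕ → ℕ) (P : ℕ → ℝ → ℝ) (Γ : ℝ → ℝ → EuclideanSpace ℝ (Fin n)),
      StrictMono φ ∧
      (∀ j, CurveShortening.IsArclengthParametrisation
        (fun q => CurveShortening.rescaledFlow γ p t A b (φ j) q 0) (p (φ j)) (P j)) ∧
      CurveShortening.IsFlow Γ (Set.Iic 0) ∧
      CurveShortening.SmoothlyConvergesOn
        (fun j (z : ℝ × ℝ) => CurveShortening.rescaledFlow γ p t A b (φ j) (P j z.1) z.2)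
        (fun z : ℝ × ℝ => Γ z.1 z.2) (Set.univ ×ˢ Set.Iic 0) ∧
      ¬ Collinear ℝ (Set.range fun x : ℝ => Γ x 0) := by
  open CurveShortening Filter Topology in
  obtain ⟨ρ, hρ, hess⟩ := hpt.essential
  have hω : 0 < ω := (hpt.mem 0).1.trans_lt (hpt.mem 0).2
  have hscale : Tendsto (fun j => scale γ p t j ^ 2) atTop atTop := hpt.blowUp
  obtain ⟨N, hN⟩ := eventually_atTop.1
    ((hpt.time.eventually_const_lt hω).and (hscale.eventually_gt_atTop 0))
  have hl : ∀ j, 0 < scale γ p t (j + N) := fun j => by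
    have h1 := (hN (j + N) (by omega)).2
    exact lt_of_le_of_ne (norm_nonneg _) fun h0 => by simp [← h0] at h1
  choose P hP hG using fun j => exists_arclength_rescaledFlow hγ hAb hρ (j + N)
    (hN (j + N) (by omega)).1 (hpt.mem (j + N)).2 (hl j) (hess (j + N))
  set G : ℕ → ℝ × ℝ → EuclideanSpace ℝ (Fin n) := fun j z =>
    rescaledFlow γ p t A b (j + N) (P j z.1) z.2
  have hex : ExhaustPast (fun j => initialTime γ p t (j + N))
      fun j => finalTime γ ω p t (j + N) := by
    refine ⟨fun j => ?_, fun j => ?_, ?_⟩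
    · exact mul_neg_of_pos_of_neg (pow_pos (hl j) 2) (by linarith [(hN (j + N) (by omega)).1])
    · exact mul_pos (pow_pos (hl j) 2) (by linarith [(hpt.mem (j + N)).2])
    · have h1 : Tendsto (fun j => 0 - t j) atTop (𝓝 (0 - ω)) := hpt.time.const_sub 0
      exact (hscale.atTop_mul_neg (by linarith) h1).comp (tendsto_add_atTop_nat N)
  have hnorm : NormalisedFlows G (fun j => initialTime γ p t (j + N))
      fun j => finalTime γ ω p t (j + N) :=
    { hex with
      flow := fun j => (hG j).flow
      unit := fun j => (hG j).unit
      base := fun j => (hG j).base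
      bound := fun m R => by
        obtain ⟨C, -, hC⟩ := StripFlow.exists_bound_tangentDeriv (EuclideanSpace ℝ (Fin n)) ρ⁻¹ m
        refine ⟨C, ?_⟩
        filter_upwards [hex.lim.eventually_lt_atBot (-R - m)] with j hj z hz
        obtain ⟨L, hL, hper⟩ := (hG j).periodic
        exact hC (G j) _ _ L (hG j).flow hper hL (hex.pos j) (hG j).bound z
          (by linarith [hz.2.1]) hz.2.2 m (by omega) }
  obtain ⟨φ, Γ, hφ, hΓ, hconv, hcol⟩ := hnorm.exists_limit (fun j => (hG j).tangent)
    (fun j => (hG j).curvature) (hG 0).curvature_ne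
  exact ⟨fun j => φ j + N, fun j => P (φ j), Γ, fun i j hij => Nat.add_lt_add_right (hφ hij) N,
    fun j => hP (φ j), hΓ, hconv, hcol⟩
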